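/- Let $T$ be a complete first-order theory with NIP. Then there is a cardinal $\lambda$ (depending only on $T$) such that the following holds for every $\kappa>\lambda$ and every $\kappa$-saturated and strongly $\kappa$-homogeneous model $\bar M$ of $T$. ("Small" means of cardinality $<\kappa$; strong $\kappa$-homogeneity means that every partial elementary map with small domain extends to an automorphism of $\bar M$.) Let $G$ be a group definable over $\emptyset$ in $\bar M^{eq}$, i.e. $G=D/{\sim}$ with $D\subseteq \bar M^n$ and an equivalence relation $\sim$ on $D$, both definable over $\emptyset$, and with group operation definable over $\emptyset$. Let $H=H_a$ be a subgroup of $G$ that is type-defined by a partial type $p(x,a)$ over a small tuple $a$ of elements of $\bar M$ (a tuple in $\bar M^n$ satisfies $p(x,a)$ if and only if it lies in $D$ and represents an element of $H$). Suppose that $G/H$ is stable: for every sequence $(c_i,b_i)_{i<\omega}$ indiscernible over $a$, with $c_i\in G/H$ and $b_i$ small tuples from $\bar M$, we have $\mathrm{tp}(c_i,b_j/a)=\mathrm{tp}(c_j,b_i/a)$ for all $i\neq j$. (Two tuples of elements of $\bar M$ and of $G/H$ have the same type over $a$ if some automorphism of $\bar M$ fixing $a$ pointwise maps one to the other.) Then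 for every small set $A\subseteq \bar M$ (in particular for $A=\emptyset$) the intersection of all conjugates of $H$ under automorphisms of $\bar M$ fixing $A$ pointwise is a bounded subintersection: there is a small set $S\subseteq \mathrm{Aut}(\bar M/A)$ with $$\bigcap_{\sigma\in \mathrm{Aut}(\bar M/A)}\sigma(H)=\bigcap_{\sigma\in S}\sigma(H),$$ and moreover, for every elementary extension $N$ of $\bar M$, $$\bigcap\{\,p(N,a') : a'\in N,\ \mathrm{tp}(a'/A)=\mathrm{tp}(a/A)\,\}=\bigcap_{\sigma\in S}p(N,\sigma(a)),$$ where $p(N,a')$ denotes the set of solutions of $p(x,a')$ in $N$. -/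

import Mathlib

universe u v w z

open FirstOrder Cardinal

namespace FirstOrder.Language

/-- `T` is NIP: for every partitioned formula `φ(x; y)` there is `n` such that in no model of `T`
does `φ` shatter a set of `n` tuples. -/
def Theory.IsNIP {L : Language.{u, v}} (T : L.Theory) : Prop :=
  ∀ (k m : ℕ) (φ : L.Formula (Fin k ⊕ Fin m)), ∃ n : ℕ,
    ∀ (N : Type w) [L.Structure N] [Nonempty N] [N ⊨ T],
      ¬ ∃ (a : Fin n → Fin k → N) (b : Set (Fin n) → Fin m → N),
        ∀ i s, φ.Realize (Sum.elim (a i) (b s)) ↔ i ∈ s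

section Structures

variable (L : Language.{u, v}) (M : Type w) [L.Structure M]

/-- `M` is `κ`-saturated: every finitely satisfiable set of formulas in one variable over a
parameter set of cardinality `< κ` is realized in `M`. -/
def IsSaturated (κ : Cardinal.{w}) : Prop :=
  ∀ A : Set M, #A < κ → ∀ p : Set (L[[A]].Formula Unit),
    (∀ q : Finset (L[[A]].Formula Unit), (q : Set (L[[A]].Formula Unit)) ⊆ p →
      ∃ x : Unit → M, ∀ φ ∈ q, φ.Realize x) →
    ∃ x : Unit → M, ∀ φ ∈ p, φ.Realize x

/-- `M` is strongly `κ`-homogeneous: every partial elementary map whose domain has cardinality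
`< κ` extends to an automorphism of `M`. -/
def IsStronglyHomogeneous (κ : Cardinal.{w}) : Prop :=
  ∀ (A : Set M) (f : A → M), #A < κ →
    (∀ φ : L.Formula A, φ.Realize (fun x : A => (x : M)) ↔ φ.Realize f) →
    ∃ σ : M ≃[L] M, ∀ x : A, σ x = f x

variable {M}

/-- The automorphisms of `M` that fix the set `A` pointwise. -/
def fixingAut (A : Set M) : Set (M ≃[L] M) :=
  {σ | ∀ x ∈ A, σ x = x}

variable (M)

/-- A presentation of the group `G` as a group definable over `∅` in `M^eq`: `G` is the quotient
of a `∅`-definable set `dom ⊆ Mⁿ` by a `∅`-definable equivalence relation (the kernel of `proj`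
on `dom`; values of `proj` outside `dom` are irrelevant), and the graph of its multiplication is
`∅`-definable. -/
structure DefinableGroup (G : Type z) [Group G] where
  /-- the length of the tuples that represent the elements of `G` -/
  n : ℕ
  /-- the set of representatives -/
  dom : Set (Fin n → M)
  /-- the element of `G` represented by a tuple in `dom` -/
  proj : (Fin n → M) → G
  surj : ∀ g : G, ∃ x ∈ dom, proj x = g
  dom_definable : (∅ : Set M).Definable L dom
  eq_definable : (∅ : Set M).Definable L
    {v : Fin 2 × Fin n → M | (∀ k, (fun i => v (k, i)) ∈ dom) ∧
      proj (fun i => v (0, i)) = proj (fun i => v (1, i))}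
  mul_definable : (∅ : Set M).Definable L
    {v : Fin 3 × Fin n → M | (∀ k, (fun i => v (k, i)) ∈ dom) ∧
      proj (fun i => v (0, i)) * proj (fun i => v (1, i)) = proj (fun i => v (2, i))}

end Structures

section Automorphisms

variable {L : Language.{u, v}} {M : Type w} [L.Structure M]

/-- Automorphisms preserve `∅`-definable sets. -/
theorem comp_mem_of_empty_definable {α : Type*} {s : Set (α → M)}
    (hs : (∅ : Set M).Definable L s) (σ : M ≃[L] M) {x : α → M} (hx : x ∈ s) :
    σ ∘ x ∈ s := by
  obtain ⟨φ, rfl⟩ := Set.empty_definable_iff.1 hs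
  exact (StrongHomClass.realize_formula σ φ).2 hx

namespace DefinableGroup

variable {G : Type z} [Group G] (D : DefinableGroup L M G)

theorem proj_comp_eq (σ : M ≃[L] M) {x y : Fin D.n → M} (hx : x ∈ D.dom) (hy : y ∈ D.dom)
    (h : D.proj x = D.proj y) : D.proj (σ ∘ x) = D.proj (σ ∘ y) :=
  (comp_mem_of_empty_definable D.eq_definable σ (x := fun q => ![x, y] q.1 q.2)
    ⟨Fin.forall_fin_two.2 ⟨hx, hy⟩, h⟩).2

theorem proj_comp_mul (σ : M ≃[L] M) {x y t : Fin D.n → M} (hx : x ∈ D.dom) (hy : y ∈ D.dom)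
    (ht : t ∈ D.dom) (h : D.proj x * D.proj y = D.proj t) :
    D.proj (σ ∘ x) * D.proj (σ ∘ y) = D.proj (σ ∘ t) :=
  (comp_mem_of_empty_definable D.mul_definable σ (x := fun q => ![x, y, t] q.1 q.2)
    ⟨by intro k; fin_cases k <;> assumption, h⟩).2

/-- The action on `G` of an automorphism of `M`. -/
noncomputable def act (σ : M ≃[L] M) : G →* G :=
  MonoidHom.mk' (fun g => D.proj (σ ∘ (D.surj g).choose)) fun g h =>
    (D.proj_comp_mul σ (D.surj g).choose_spec.1 (D.surj h).choose_spec.1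
      (D.surj (g * h)).choose_spec.1
      (by rw [(D.surj g).choose_spec.2, (D.surj h).choose_spec.2,
        (D.surj (g * h)).choose_spec.2])).symm

/-- The action on `G` is the coordinatewise action on representatives. -/
theorem act_proj (σ : M ≃[L] M) {x : Fin D.n → M} (hx : x ∈ D.dom) :
    D.act σ (D.proj x) = D.proj (σ ∘ x) :=
  D.proj_comp_eq σ (D.surj (D.proj x)).choose_spec.1 hx (D.surj (D.proj x)).choose_spec.2

/-- The automorphism `σ` takes the coset `c ∈ G/H` to the coset `d`. This is used only for `σ`
that fixes parameters defining `H`, so that `σ` acts on `G/H`. -/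
def MapsCoset (H : Subgroup G) (σ : M ≃[L] M) (c d : G ⧸ H) : Prop :=
  ∃ g : G, (g : G ⧸ H) = c ∧ (D.act σ g : G ⧸ H) = d

/-- Stability of the hyperdefinable set `G/H`, where `H` is type-definable over `B`: whenever
`(cᵢ, bᵢ)`, `i < ω`, is indiscernible over `B`, with `cᵢ ∈ G/H` and `bᵢ` small tuples from `M`,
the pairs `(cᵢ, bⱼ)` and `(cⱼ, bᵢ)` have the same type over `B` for `i ≠ j`. As usual for
hyperimaginaries in a monster model, having the same type over `B` means being conjugate by an
automorphism that fixes `B` pointwise. -/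
def IsStableQuotient (κ : Cardinal.{w}) (H : Subgroup G) (B : Set M) : Prop :=
  ∀ (β : Type w), #β < κ → ∀ (c : ℕ → G ⧸ H) (b : ℕ → β → M),
    (∀ (m : ℕ) (s t : Fin m → ℕ), StrictMono s → StrictMono t →
      ∃ σ ∈ fixingAut L B, ∀ k, D.MapsCoset H σ (c (s k)) (c (t k)) ∧ σ ∘ b (s k) = b (t k)) →
    ∀ i j, i ≠ j → ∃ σ ∈ fixingAut L B, D.MapsCoset H σ (c i) (c j) ∧ σ ∘ b j = b i

end DefinableGroup

end Automorphisms

section TypeDefinable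

variable {L : Language.{u, v}} {α ι : Type*}

/-- The set `X_a` of solutions in `N` of the partial type `p(x, a)`. -/
def solutionSet {N : Type*} [L.Structure N] (p : Set (L.Formula (α ⊕ ι))) (a : ι → N) :
    Set (α → N) :=
  {x | ∀ φ ∈ p, φ.Realize (Sum.elim x a)}

/-- The subgroup `H` of `G` is type-defined over the tuple `a` by the partial type `p(x, a)`:
the tuples that represent elements of `H` are exactly the solutions of `p(x, a)`. -/
def DefinableGroup.IsTypeDefinedBy {M : Type*} [L.Structure M] {G : Type*} [Group G]
    (D : DefinableGroup L M G) (H : Subgroup G) (p : Set (L.Formula (Fin D.n ⊕ ι)))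
    (a : ι → M) : Prop :=
  {x | x ∈ D.dom ∧ D.proj x ∈ H} = solutionSet p a

/-- For an elementary extension `N` of `M`, the realizations in `N` of `tp(a/A)`. -/
def typeRealizations {M N : Type*} [L.Structure M] [L.Structure N] (f : M ↪ₑ[L] N)
    (A : Set M) (a : ι → M) : Set (ι → N) :=
  {a' | ∀ φ : L.Formula (A ⊕ ι),
    φ.Realize (Sum.elim (fun x : A => (x : M)) a) ↔
      φ.Realize (Sum.elim (fun x : A => f x) a')}

end TypeDefinable

end FirstOrder.Language

namespace FirstOrder.Language

/-! ### Types, saturation and homogeneity for small tuples -/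

section TypesAndAutomorphisms

variable {L : Language.{u, v}} {M : Type w} [L.Structure M]

/-! It suffices to treat one formula ψ ∈ p at a time: finitely many conjugates of H over A have
intersection inside every conjugate of ψ (`exists_finset`). The union of these finite families over
ψ ∈ p is small once κ exceeds ℵ₀ and |L|, and compactness carries each inclusion to elementary
extensions.

If this fails for ψ, there are conjugates H_n of H, with parameters a_n, and elements c_n lying in
H_m for all m < n with ¬ψ(c_n, a_n). The sequence (a_n, c_n) may be replaced by an indiscernible one
indexed by ℚ. The contradiction comes from a Baldwin–Saxl argument (`false_of_isNIP`): NIP forbids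
arbitrarily long families f_k with f_k ∈ H_i for i ≠ k and f_k uniformly outside H_k. Indeed, by
compactness some θ satisfies H·θ·H ⊆ ψ, and the products of the f_k over subsets of indices shatter
the parameters.

If c_0 ∈ H_1, indiscernibility makes the c_k such a family. Otherwise a single χ ∈ p keeps c_0 out
of every H_q, q > 0, and stability enters. For K = H_{m+1} ∩ … ∩ H_n the quotient G/K is stable
(`IsSeqStable.inf`), so the cosets c_0 K and c_{m+1/2} K have the same type over a_1, …, a_m and the
parameters of K (`exists_shift`). Since c_{m+1/2} lies in H_1 ∩ … ∩ H_m, this yields c_0 = g_m E_m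
with g_m ∈ H_i for 1 ≤ i ≤ m and E_m ∈ H_i for m < i ≤ n. Then g_{k+1}⁻¹ g_k = E_{k+1} E_k⁻¹ lies in
every H_i with i ≠ k+1, while multiplying it by g_{k+1} on the left and E_k on the right, both in
H_{k+1}, gives c_0 ∉ H_{k+1}. NIP is contradicted again. -/

theorem Formula.realize_restrictFreeVar_iff {γ δ : Type*} [DecidableEq γ] {φ : L.Formula γ}
    {f : φ.freeVarFinset → δ} {x : δ → M} (y : γ → M) (h : ∀ a, x (f a) = y a) :
    Formula.Realize (φ.restrictFreeVar f : L.Formula δ) x ↔ φ.Realize y :=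
  BoundedFormula.realize_restrictFreeVar y h

theorem Formula.realize_congr_freeVar {γ : Type*} [DecidableEq γ] (φ : L.Formula γ) {x y : γ → M}
    (h : ∀ a ∈ φ.freeVarFinset, x a = y a) : φ.Realize x ↔ φ.Realize y :=
  ((Formula.realize_restrictFreeVar_iff (f := fun a => (a : γ)) x fun _ => rfl).symm).trans
    (Formula.realize_restrictFreeVar_iff y fun a => h a a.2)

/-- Existential quantification over an arbitrary family of variables. -/
theorem Formula.exists_realize_iff {δ γ : Type*} (φ : L.Formula (δ ⊕ γ)) :
    ∃ ψ : L.Formula δ, ∀ (N : Type w) [L.Structure N] [Nonempty N] (d : δ → N),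
      ψ.Realize d ↔ ∃ x : γ → N, φ.Realize (Sum.elim d x) := by
  classical
  let f : φ.freeVarFinset → δ ⊕ φ.freeVarFinset := fun a =>
    match a with
    | ⟨Sum.inl b, _⟩ => Sum.inl b
    | ⟨Sum.inr c, h⟩ => Sum.inr ⟨Sum.inr c, h⟩
  refine ⟨Formula.iExs φ.freeVarFinset (φ.restrictFreeVar f), fun N _ _ d => ?_⟩
  rw [Formula.realize_iExs]
  constructor
  · rintro ⟨i, hi⟩
    obtain ⟨n0⟩ := ‹Nonempty N›
    refine ⟨fun c => if h : Sum.inr c ∈ φ.freeVarFinset then i ⟨_, h⟩ else n0, ?_⟩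
    refine (Formula.realize_restrictFreeVar_iff _ ?_).1 hi
    rintro ⟨b | c, h⟩
    · rfl
    · simp [f, h]
  · rintro ⟨x, hx⟩
    refine ⟨fun a => Sum.elim d x a, (Formula.realize_restrictFreeVar_iff _ ?_).2 hx⟩
    rintro ⟨b | c, h⟩ <;> rfl

theorem fixingAut_comp {B : Set M} {σ τ : M ≃[L] M} (hσ : σ ∈ fixingAut L B)
    (hτ : τ ∈ fixingAut L B) : σ.comp τ ∈ fixingAut L B := fun x hx => by
  rw [Equiv.comp_apply, hτ x hx, hσ x hx]

theorem fixingAut_symm {B : Set M} {σ : M ≃[L] M} (hσ : σ ∈ fixingAut L B) :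
    σ.symm ∈ fixingAut L B := fun x hx => by
  have := Equiv.symm_apply_apply σ x
  rwa [hσ x hx] at this

theorem fixingAut_mono {B C : Set M} (h : B ⊆ C) : fixingAut L C ⊆ fixingAut L B :=
  fun _ hσ x hx => hσ x (h hx)

variable {κ : Cardinal.{w}}

/-- In a strongly homogeneous structure, small tuples with the same type over a small set are
conjugate. -/
theorem IsStronglyHomogeneous.exists_fixingAut (hom : IsStronglyHomogeneous L M κ)
    (hκ : ℵ₀ ≤ κ) {B : Set M} (hB : #B < κ) {γ : Type*} {x y : γ → M} (hx : #(Set.range x) < κ)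
    (h : ∀ φ : L.Formula (B ⊕ γ),
      φ.Realize (Sum.elim (↑) x) ↔ φ.Realize (Sum.elim (↑) y)) :
    ∃ σ ∈ fixingAut L B, ∀ i, σ (x i) = y i := by
  have hc : ∀ a : (B ∪ Set.range x : Set M), ∃ c : B ⊕ γ, Sum.elim (↑) x c = (a : M) := by
    rintro ⟨a, ha | ⟨i, rfl⟩⟩
    · exact ⟨Sum.inl ⟨a, ha⟩, rfl⟩
    · exact ⟨Sum.inr i, rfl⟩
  choose c hc using hc
  have hcard : #(B ∪ Set.range x : Set M) < κ :=
    (Cardinal.mk_union_le _ _).trans_lt (Cardinal.add_lt_of_lt hκ hB hx)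
  obtain ⟨σ, hσ⟩ := hom (B ∪ Set.range x) (fun a => Sum.elim (↑) y (c a)) hcard fun φ => by
    have h1 := h (φ.relabel c)
    rw [Formula.realize_relabel, Formula.realize_relabel] at h1
    have e : (Sum.elim (↑) x ∘ c : (B ∪ Set.range x : Set M) → M) = (↑) := funext hc
    rw [e] at h1
    exact h1
  -- The chosen name `c a` of a point does not matter: coincidences among entries are part of the
  -- type.
  have key : ∀ (a : (B ∪ Set.range x : Set M)) (d : B ⊕ γ), Sum.elim (↑) x d = (a : M) →
      σ a = Sum.elim (↑) y d := by
    intro a d hd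
    have h1 := h (Term.equal (Term.var (c a)) (Term.var d))
    simp only [Formula.realize_equal, Term.realize_var] at h1
    exact (hσ a).trans (h1.1 ((hc a).trans hd.symm))
  exact ⟨σ, fun b hb => key ⟨b, Or.inl hb⟩ (Sum.inl ⟨b, hb⟩) rfl,
    fun i => key ⟨x i, Or.inr ⟨i, rfl⟩⟩ (Sum.inr i) rfl⟩

/-- Automorphisms over `B` preserve formulas with parameters from `B`. -/
theorem realize_iff_of_fixingAut {B : Set M} {γ : Type*} {x y : γ → M} {σ : M ≃[L] M}
    (hσ : σ ∈ fixingAut L B) (φ : L.Formula (B ⊕ γ))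
    (h : ∀ i, σ (x i) = y i) :
    φ.Realize (Sum.elim (↑) x) ↔ φ.Realize (Sum.elim (↑) y) := by
  rw [← StrongHomClass.realize_formula σ φ (v := Sum.elim (↑) x)]
  have : (σ ∘ Sum.elim (↑) x : B ⊕ γ → M) = Sum.elim (↑) y := by
    ext (b | i)
    · exact hσ b b.2
    · exact h i
  rw [this]

/-- Small tuples are conjugate over a small set if their finite parts are. -/
theorem IsStronglyHomogeneous.exists_fixingAut_of_finite (hom : IsStronglyHomogeneous L M κ)
    (hκ : ℵ₀ ≤ κ) {B : Set M} (hB : #B < κ) {γ : Type*} {x y : γ → M} (hx : #(Set.range x) < κ)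
    (h : ∀ s : Finset γ, ∃ σ ∈ fixingAut L B, ∀ i ∈ s, σ (x i) = y i) :
    ∃ σ ∈ fixingAut L B, ∀ i, σ (x i) = y i := by
  classical
  refine hom.exists_fixingAut hκ hB hx fun φ => ?_
  obtain ⟨σ, hσ, hs⟩ := h (φ.freeVarFinset.preimage Sum.inr Sum.inr_injective.injOn)
  rw [realize_iff_of_fixingAut hσ φ (y := fun i => σ (x i)) fun _ => rfl]
  refine φ.realize_congr_freeVar ?_
  rintro (b | i) hi
  · rfl
  · exact hs i (by simpa using hi)

/-- Finite satisfiability of `Q` together with the conditions `xᵢ = m` for `(i, m) ∈ Γ`. -/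
def FinSat {γ : Type*} (Q : Set (L.Formula γ)) (Γ : Set (γ × M)) : Prop :=
  ∀ (q : Finset (L.Formula γ)) (s : Finset (γ × M)), (q : Set _) ⊆ Q → (s : Set _) ⊆ Γ →
    ∃ x : γ → M, (∀ φ ∈ q, φ.Realize x) ∧ ∀ j ∈ s, x j.1 = j.2

theorem FinSat.eq_of_mem {γ : Type*} {Q : Set (L.Formula γ)} {Γ : Set (γ × M)}
    (h : FinSat Q Γ) {i : γ} {m n : M} (hm : (i, m) ∈ Γ) (hn : (i, n) ∈ Γ) : m = n := by
  classical
  obtain ⟨x, -, hx⟩ := h ∅ {(i, m), (i, n)} (by simp) (by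
    intro j hj
    simp only [Finset.coe_insert, Finset.coe_singleton, Set.mem_insert_iff,
      Set.mem_singleton_iff] at hj
    rcases hj with rfl | rfl <;> assumption)
  exact (hx (i, m) (by simp)).symm.trans (hx (i, n) (by simp))

/-- The finite conditions on the value of the variable `i` become, after quantifying out the other
variables, a 1-type over the values already assigned; saturation realizes it. -/
theorem FinSat.exists_insert [Nonempty M] (sat : IsSaturated L M κ) {γ : Type w} (hγ : #γ < κ)
    {Q : Set (L.Formula γ)} {Γ : Set (γ × M)} (h : FinSat Q Γ) (i : γ) :
    ∃ m, FinSat Q (insert (i, m) Γ) := by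
  classical
  let A : Set M := Prod.snd '' Γ
  have hA : #A < κ := by
    refine lt_of_le_of_lt (Cardinal.mk_image_le.trans ?_) hγ
    refine Cardinal.mk_le_of_injective (f := fun j : Γ => j.1.1) ?_
    rintro ⟨⟨a, b⟩, h1⟩ ⟨⟨c, d⟩, h2⟩ (rfl : a = c)
    have := h.eq_of_mem h1 h2
    subst this
    rfl
  have hform : ∀ (q : Finset (L.Formula γ)) (s : Finset (γ × M)), (s : Set _) ⊆ Γ →
      ∃ θ : L[[A]].Formula Unit, ∀ t : Unit → M, θ.Realize t ↔
        ∃ x : γ → M, (∀ φ ∈ q, φ.Realize x) ∧ (∀ j ∈ s, x j.1 = j.2) ∧ x i = t () := by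
    intro q s hs
    let χ : L.Formula ((A ⊕ Unit) ⊕ γ) :=
      (Formula.iInf fun φ : q => φ.1.relabel Sum.inr) ⊓
      ((Formula.iInf fun j : s => Term.equal (Term.var (Sum.inr j.1.1))
        (Term.var (Sum.inl (Sum.inl ⟨j.1.2, ⟨j.1, hs j.2, rfl⟩⟩)))) ⊓
      Term.equal (Term.var (Sum.inr i)) (Term.var (Sum.inl (Sum.inr ()))))
    obtain ⟨ψ, hψ⟩ := Formula.exists_realize_iff.{u, v, w} χ
    refine ⟨BoundedFormula.constantsVarsEquiv.symm ψ, fun t => ?_⟩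
    have e : Formula.Realize (BoundedFormula.constantsVarsEquiv.symm ψ : L[[A]].Formula Unit) t ↔
        ψ.Realize (Sum.elim (fun a : A => (a : M)) t) := by
      have := BoundedFormula.realize_constantsVarsEquiv (L := L) (M := M) (α := A)
        (φ := BoundedFormula.constantsVarsEquiv.symm ψ) (v := t) (xs := default)
      rw [_root_.Equiv.apply_symm_apply] at this
      exact this.symm
    rw [e, hψ]
    refine exists_congr fun x => ?_
    simp only [χ, Formula.realize_inf, Formula.realize_iInf, Formula.realize_relabel,
      Formula.realize_equal, Term.realize_var, Sum.elim_comp_inr, Sum.elim_inr, Sum.elim_inl,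
      Subtype.forall, Prod.forall]
  let p : Set (L[[A]].Formula Unit) := {θ | ∃ (q : Finset (L.Formula γ)) (s : Finset (γ × M)),
    (q : Set _) ⊆ Q ∧ (s : Set _) ⊆ Γ ∧ ∀ t : Unit → M, θ.Realize t ↔
        ∃ x : γ → M, (∀ φ ∈ q, φ.Realize x) ∧ (∀ j ∈ s, x j.1 = j.2) ∧ x i = t ()}
  obtain ⟨t, ht⟩ := sat A hA p fun r hr => by
    choose! q s hq hs hqs using hr
    obtain ⟨x, hx1, hx2⟩ := h (r.biUnion q) (r.biUnion s)
      (by simpa using fun θ hθ => hq hθ) (by simpa using fun θ hθ => hs hθ)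
    refine ⟨fun _ => x i, fun θ hθ => (hqs hθ _).2 ⟨x, ?_, ?_, rfl⟩⟩
    · exact fun φ hφ => hx1 φ (Finset.mem_biUnion.2 ⟨θ, hθ, hφ⟩)
    · exact fun j hj => hx2 j (Finset.mem_biUnion.2 ⟨θ, hθ, hj⟩)
  refine ⟨t (), fun q s hq hs => ?_⟩
  have hs' : ((s.erase (i, t ()) : Finset _) : Set (γ × M)) ⊆ Γ := by
    intro j hj
    rw [Finset.coe_erase] at hj
    exact (hs hj.1).resolve_left hj.2
  obtain ⟨θ, hθ⟩ := hform q _ hs'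
  obtain ⟨x, hx1, hx2, hx3⟩ := (hθ t).1 (ht θ ⟨q, _, hq, hs', hθ⟩)
  refine ⟨x, hx1, fun j hj => ?_⟩
  by_cases hji : j = (i, t ())
  · subst hji
    exact hx3
  · exact hx2 j (Finset.mem_erase.2 ⟨hji, hj⟩)

/-- A maximal finitely satisfiable set of assignments, given by Zorn, assigns a value to every
variable. Each formula sees only finitely many of them. -/
theorem FinSat.exists_realize [Nonempty M] (sat : IsSaturated L M κ) {γ : Type w} (hγ : #γ < κ)
    {Q : Set (L.Formula γ)} {Γ : Set (γ × M)} (h : FinSat Q Γ) :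
    ∃ x : γ → M, (∀ φ ∈ Q, φ.Realize x) ∧ ∀ j ∈ Γ, x j.1 = j.2 := by
  classical
  obtain ⟨Δ, hΓΔ, hΔ⟩ := zorn_subset_nonempty {Δ : Set (γ × M) | FinSat Q Δ} (by
    intro c hc hchain hne
    refine ⟨⋃₀ c, fun q s hq hs => ?_, fun Δ hΔ => Set.subset_sUnion_of_mem hΔ⟩
    obtain ⟨Δ, hΔ, hsΔ⟩ := DirectedOn.exists_mem_subset_of_finset_subset_biUnion (f := id)
      (s := s) hne hchain.directedOn (by simpa [Set.sUnion_eq_biUnion] using hs)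
    exact hc hΔ q s hq hsΔ) Γ h
  have hmem : ∀ i, ∃ m, (i, m) ∈ Δ := fun i => by
    obtain ⟨m, hm⟩ := FinSat.exists_insert sat hγ hΔ.prop i
    exact ⟨m, hΔ.le_of_ge hm (Set.subset_insert _ _) (Set.mem_insert _ _)⟩
  choose x hx using hmem
  refine ⟨x, fun φ hφ => ?_, fun j hj => hΔ.prop.eq_of_mem (hx j.1) (hΓΔ hj)⟩
  obtain ⟨y, hy1, hy2⟩ := hΔ.prop {φ} (φ.freeVarFinset.image fun i => (i, x i))
    (by simpa using hφ) (by
      intro j hj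
      simp only [Finset.coe_image, Set.mem_image, Finset.mem_coe] at hj
      obtain ⟨i, -, rfl⟩ := hj
      exact hx i)
  refine (φ.realize_congr_freeVar fun i hi => ?_).1 (hy1 φ (by simp))
  exact hy2 (i, x i) (Finset.mem_image.2 ⟨i, hi, rfl⟩)

/-- Saturation for types in a small family of variables. -/
theorem IsSaturated.exists_realize [Nonempty M] (sat : IsSaturated L M κ) (hκ : ℵ₀ ≤ κ)
    {E γ : Type w} (hE : #E < κ) (hγ : #γ < κ) (e : E → M) (Q : Set (L.Formula (E ⊕ γ)))
    (h : ∀ q : Finset (L.Formula (E ⊕ γ)), (q : Set _) ⊆ Q →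
      ∃ x : γ → M, ∀ φ ∈ q, φ.Realize (Sum.elim e x)) :
    ∃ x : γ → M, ∀ φ ∈ Q, φ.Realize (Sum.elim e x) := by
  have hc : #(E ⊕ γ) < κ := by
    rw [Cardinal.mk_sum, Cardinal.lift_id, Cardinal.lift_id]
    exact Cardinal.add_lt_of_lt hκ hE hγ
  obtain ⟨x, hx1, hx2⟩ := FinSat.exists_realize sat hc (Q := Q)
    (Γ := Set.range fun i => (Sum.inl i, e i)) (by
      intro q s hq hs
      obtain ⟨x, hx⟩ := h q hq
      refine ⟨Sum.elim e x, hx, fun j hj => ?_⟩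
      obtain ⟨i, rfl⟩ := hs hj
      rfl)
  refine ⟨x ∘ Sum.inr, fun φ hφ => ?_⟩
  have : Sum.elim e (x ∘ Sum.inr) = x := by
    ext (i | i)
    · exact (hx2 (Sum.inl i, e i) ⟨i, rfl⟩).symm
    · rfl
  rw [this]
  exact hx1 φ hφ

end TypesAndAutomorphisms

/-! ### Iterated ultrafilter limits, used in place of Ramsey's theorem -/

section IteratedLimits

/-- The distribution of a function `J → ℕ` whose values at the entries of a list are chosen one
after the other generically with respect to `U`, and which agrees with `x` elsewhere. -/
noncomputable def iterLim {J : Type*} [DecidableEq J] (U : Ultrafilter ℕ) :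
    List J → (J → ℕ) → Ultrafilter (J → ℕ)
  | [], x => pure x
  | q :: l, x => U.bind fun i => iterLim U l (Function.update x q i)

variable {J : Type*} [DecidableEq J] {U : Ultrafilter ℕ}

theorem eventually_iterLim_nil {x : J → ℕ} {P : (J → ℕ) → Prop} :
    (∀ᶠ t in (iterLim U [] x : Filter (J → ℕ)), P t) ↔ P x :=
  Iff.rfl

theorem eventually_iterLim_cons {q : J} {l : List J} {x : J → ℕ} {P : (J → ℕ) → Prop} :
    (∀ᶠ t in (iterLim U (q :: l) x : Filter (J → ℕ)), P t) ↔
      ∀ᶠ i in (U : Filter ℕ),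
        ∀ᶠ t in (iterLim U l (Function.update x q i) : Filter (J → ℕ)), P t :=
  Iff.rfl

theorem eventually_iterLim_eq (l : List J) (x : J → ℕ) :
    ∀ᶠ t in (iterLim U l x : Filter (J → ℕ)), ∀ j ∉ l, t j = x j := by
  induction l generalizing x with
  | nil => exact eventually_iterLim_nil.2 fun _ _ => rfl
  | cons q l ih =>
    refine eventually_iterLim_cons.2 (Filter.Eventually.of_forall fun i => ?_)
    filter_upwards [ih (Function.update x q i)] with t ht j hj
    rw [List.mem_cons, not_or] at hj
    rw [ht j hj.2, Function.update_of_ne hj.1]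

/-- Entries on which the property does not depend can be dropped. -/
theorem eventually_iterLim_filter (l : List J) (S : Set J) [DecidablePred (· ∈ S)]
    {P : (J → ℕ) → Prop} (hP : ∀ t t' : J → ℕ, (∀ j ∈ S, t j = t' j) → (P t ↔ P t'))
    {x x' : J → ℕ} (h : ∀ j ∈ S, j ∉ l → x j = x' j) :
    (∀ᶠ t in (iterLim U l x : Filter (J → ℕ)), P t) ↔
      ∀ᶠ t in (iterLim U (l.filter (· ∈ S)) x' : Filter (J → ℕ)), P t := by
  induction l generalizing x x' with
  | nil => exact hP _ _ fun j hj => h j hj (by simp)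
  | cons q l ih =>
    rw [eventually_iterLim_cons]
    by_cases hq : q ∈ S
    · rw [List.filter_cons_of_pos (by simpa using hq), eventually_iterLim_cons]
      refine Filter.eventually_congr (Filter.Eventually.of_forall fun i => ih fun j hj hjl => ?_)
      by_cases hjq : j = q
      · subst hjq; simp
      · rw [Function.update_of_ne hjq, Function.update_of_ne hjq]
        exact h j hj (by simp [hjq, hjl])
    · rw [List.filter_cons_of_neg (by simpa using hq)]
      refine (Filter.eventually_congr (Filter.Eventually.of_forall fun i => ih (x' := x')
        fun j hj hjl => ?_)).trans Filter.eventually_const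
      have hjq : j ≠ q := fun e => hq (e ▸ hj)
      rw [Function.update_of_ne hjq]
      exact h j hj (by simp [hjq, hjl])

theorem eventually_iterLim_map {K : Type*} [DecidableEq K] (f : K → J) (hf : f.Injective)
    (l : List K) (x : J → ℕ) (P : (K → ℕ) → Prop) :
    (∀ᶠ t in (iterLim U (l.map f) x : Filter (J → ℕ)), P (t ∘ f)) ↔
      ∀ᶠ t in (iterLim U l (x ∘ f) : Filter (K → ℕ)), P t := by
  induction l generalizing x with
  | nil => exact Iff.rfl
  | cons q l ih =>
    rw [List.map_cons, eventually_iterLim_cons, eventually_iterLim_cons]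
    refine Filter.eventually_congr (Filter.Eventually.of_forall fun i => ?_)
    rw [ih, Function.update_comp_eq_of_injective x hf]

/-- Each entry is chosen after its predecessors along a nonprincipal ultrafilter, so it almost
surely exceeds them and any fixed bound. -/
theorem eventually_iterLim_pairwise (l : List J) (hl : l.Nodup) (x : J → ℕ) (N : ℕ) :
    ∀ᶠ t in (iterLim (Filter.hyperfilter ℕ) l x : Filter (J → ℕ)),
      l.Pairwise (fun a b => t a < t b) ∧ ∀ a ∈ l, N < t a := by
  induction l generalizing x N with
  | nil => exact eventually_iterLim_nil.2 ⟨List.Pairwise.nil, by simp⟩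
  | cons q l ih =>
    rw [List.nodup_cons] at hl
    rw [eventually_iterLim_cons]
    have h1 : ∀ᶠ i in (Filter.hyperfilter ℕ : Filter ℕ), N < i :=
      (Filter.eventually_gt_atTop N).filter_mono Nat.hyperfilter_le_atTop
    filter_upwards [h1] with i hi
    filter_upwards [ih hl.2 (Function.update x q i) i, eventually_iterLim_eq l _] with t ht1 ht2
    have htq : t q = i := by rw [ht2 q hl.1, Function.update_self]
    refine ⟨List.pairwise_cons.2 ⟨fun a ha => htq ▸ ht1.2 a ha, ht1.1⟩, fun a ha => ?_⟩
    rcases List.mem_cons.1 ha with rfl | ha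
    · rwa [htq]
    · exact hi.trans (ht1.2 a ha)

theorem eventually_iterLim_strictMono (m : ℕ) (x : Fin m → ℕ) :
    ∀ᶠ t in (iterLim (Filter.hyperfilter ℕ) (List.ofFn fun i : Fin m => i) x :
      Filter (Fin m → ℕ)), StrictMono t := by
  filter_upwards [eventually_iterLim_pairwise (List.ofFn fun i : Fin m => i)
    (List.nodup_ofFn.2 Function.injective_id) x 0] with t ht i j hij
  exact List.pairwise_ofFn.1 ht.1 hij

/-- The limit distribution seen at increasing positions depends only on their number. This is the
source of indiscernibility. -/
theorem eventually_iterLim_sort {m : ℕ} {s : Fin m → ℚ} (hs : StrictMono s) {Q : Finset ℚ}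
    (hQ : ∀ i, s i ∈ Q) (x : ℚ → ℕ) (x' : Fin m → ℕ) (P : (Fin m → ℕ) → Prop) :
    (∀ᶠ t in (iterLim U Q.sort x : Filter (ℚ → ℕ)), P (t ∘ s)) ↔
      ∀ᶠ t in (iterLim U (List.ofFn fun i : Fin m => i) x' : Filter (Fin m → ℕ)), P t := by
  classical
  obtain ⟨x'', rfl⟩ : ∃ x'' : ℚ → ℕ, x'' ∘ s = x' :=
    ⟨Function.extend s x' 0, funext fun i => hs.injective.extend_apply _ _ i⟩
  rw [← eventually_iterLim_map s hs.injective]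
  refine (eventually_iterLim_filter (P := fun t => P (t ∘ s)) (x := x) (x' := x'') Q.sort
    (Set.range s) ?_ ?_).trans ?_
  rotate_left 2
  · have : Q.sort.filter (· ∈ Set.range s) = (List.ofFn fun i : Fin m => i).map s := by
      rw [List.map_ofFn]
      refine List.Perm.eq_of_pairwise' (r := (· < ·)) ?_ ?_ ?_
      · exact (Finset.sortedLT_sort Q).pairwise.filter _
      · exact List.pairwise_ofFn.2 fun i j hij => hs hij
      · refine (List.perm_ext_iff_of_nodup ?_ ?_).2 ?_
        · exact (Finset.sort_nodup _ _).filter _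
        · exact List.nodup_ofFn.2 hs.injective
        · intro a
          simp only [List.mem_filter, Finset.mem_sort, List.mem_ofFn, Set.mem_range,
            decide_eq_true_eq, Function.comp]
          exact ⟨fun h => h.2, fun h => ⟨by obtain ⟨i, rfl⟩ := h; exact hQ i, h⟩⟩
    rw [this]
  · intro t t' h
    have : t ∘ s = t' ∘ s := funext fun i => h _ ⟨i, rfl⟩
    simp only [this]
  · rintro _ ⟨i, rfl⟩ h
    exact absurd ((Finset.mem_sort _).2 (hQ i)) h

end IteratedLimits

/-! ### Indiscernible sequences -/

section Indiscernible

variable {L : Language.{u, v}} {M : Type w} [L.Structure M]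

/-- The sequence of tuples `y` is indiscernible over `B`: its finite increasing subsequences of
the same length are conjugate over `B`. -/
def IsIndiscernible (L : Language.{u, v}) [L.Structure M] {I β : Type*} [LinearOrder I] (B : Set M)
    (y : I → β → M) : Prop :=
  ∀ (m : ℕ) (s t : Fin m → I), StrictMono s → StrictMono t →
    ∃ σ ∈ fixingAut L B, ∀ k, σ ∘ y (s k) = y (t k)

variable {κ : Cardinal.{w}}

theorem mk_prod_lt_of_countable (hκ : ℵ₀ < κ) {I : Type} [Countable I] {β : Type w} (hβ : #β < κ) :
    #(I × β) < κ := by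
  rw [Cardinal.mk_prod, Cardinal.lift_id']
  refine Cardinal.mul_lt_of_lt hκ.le ?_ (by simpa using hβ)
  exact (Cardinal.lift_le_aleph0.2 (Cardinal.mk_le_aleph0_iff.2 ‹_›)).trans_lt hκ

theorem mk_range_prod_lt (hκ : ℵ₀ < κ) {J : Type} [Countable J] {β : Type w} (hβ : #β < κ)
    (x : J × β → M) : #(Set.range x) < κ :=
  Cardinal.mk_range_le.trans_lt (mk_prod_lt_of_countable hκ hβ)

/-- In an indiscernible sequence any two countable subfamilies of the same order type are
conjugate. -/
theorem IsIndiscernible.exists_fixingAut (hom : IsStronglyHomogeneous L M κ) (hκ : ℵ₀ < κ)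
    {B : Set M} (hB : #B < κ) {I : Type*} [LinearOrder I] {β : Type w} (hβ : #β < κ)
    {y : I → β → M} (hy : IsIndiscernible L B y) {J : Type} [Countable J] (s t : J → I)
    (hst : ∀ i j, s i < s j ↔ t i < t j) :
    ∃ σ ∈ fixingAut L B, ∀ j, σ ∘ y (s j) = y (t j) := by
  classical
  have inj : ∀ i j, s i = s j → t i = t j := fun i j h =>
    le_antisymm (not_lt.1 fun h' => h.not_gt ((hst _ _).2 h'))
      (not_lt.1 fun h' => h.not_lt ((hst _ _).2 h'))
  obtain ⟨σ, hσ, h⟩ := hom.exists_fixingAut_of_finite hκ.le hB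
    (x := fun z : J × β => y (s z.1) z.2) (y := fun z : J × β => y (t z.1) z.2)
    (mk_range_prod_lt hκ hβ _) fun F => by
      let S : Finset I := (F.image Prod.fst).image s
      let e := S.orderEmbOfFin rfl
      have he : ∀ k, ∃ j ∈ F.image Prod.fst, s j = e k := fun k =>
        Finset.mem_image.1 (S.orderEmbOfFin_mem rfl k)
      choose r hr hre using he
      obtain ⟨σ, hσ, h⟩ := hy _ e (t ∘ r) e.strictMono fun k l hkl => by
        have := e.strictMono hkl
        rw [← hre, ← hre] at this
        exact (hst _ _).1 this
      refine ⟨σ, hσ, fun z hz => ?_⟩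
      obtain ⟨k, hk⟩ : s z.1 ∈ Set.range e := by
        rw [Finset.range_orderEmbOfFin]
        exact Finset.mem_image_of_mem _ (Finset.mem_image_of_mem _ hz)
      have h1 := congrFun (h k) z.2
      rw [hk] at h1
      rw [← inj (r k) z.1 ((hre k).trans hk)]
      exact h1
  exact ⟨σ, hσ, fun j => funext fun b => h (j, b)⟩

/-- Every sequence has an indiscernible sequence of the order type of `ℚ` that satisfies every
formula which holds for all increasing tuples of the given sequence. -/
theorem exists_isIndiscernible [Nonempty M] (sat : IsSaturated L M κ)
    (hom : IsStronglyHomogeneous L M κ) (hκ : ℵ₀ < κ) {B : Set M} (hB : #B < κ)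
    {β : Type w} (hβ : #β < κ) (y : ℕ → β → M) :
    ∃ y' : ℚ → β → M, IsIndiscernible L B y' ∧
      ∀ (m : ℕ) (φ : L.Formula (B ⊕ (Fin m × β))),
        (∀ t : Fin m → ℕ, StrictMono t →
          φ.Realize (Sum.elim (↑) fun z : Fin m × β => y (t z.1) z.2)) →
        ∀ s : Fin m → ℚ, StrictMono s →
          φ.Realize (Sum.elim (↑) fun z : Fin m × β => y' (s z.1) z.2) := by
  classical
  let U := Filter.hyperfilter ℕ
  -- The limit type of a ℚ-indexed sequence: a formula belongs to it if its iterated limit is true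
  -- along every sufficiently large finite set of positions.
  let Q : Set (L.Formula (B ⊕ (ℚ × β))) := {φ | ∀ᶠ R : Finset ℚ in Filter.atTop,
    ∀ᶠ t in (iterLim U R.sort 0 : Filter (ℚ → ℕ)),
      φ.Realize (Sum.elim (↑) fun z : ℚ × β => y (t z.1) z.2)}
  obtain ⟨x, hx⟩ := sat.exists_realize hκ.le hB (mk_prod_lt_of_countable (I := ℚ) hκ hβ) (↑) Q
    fun q hq => by
      obtain ⟨R, hR⟩ := ((Filter.eventually_all_finset q).2 fun φ hφ => hq hφ).exists
      obtain ⟨t, ht⟩ := ((Filter.eventually_all_finset q).2 fun φ hφ => hR φ hφ).exists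
      exact ⟨_, ht⟩
  have key : ∀ (m : ℕ) (φ : L.Formula (B ⊕ (Fin m × β))) (s : Fin m → ℚ), StrictMono s →
      (φ.Realize (Sum.elim (↑) fun z : Fin m × β => x (s z.1, z.2)) ↔
        ∀ᶠ t in (iterLim U (List.ofFn fun i : Fin m => i) 0 : Filter (Fin m → ℕ)),
          φ.Realize (Sum.elim (↑) fun z : Fin m × β => y (t z.1) z.2)) := by
    intro m
    have h1 : ∀ (φ : L.Formula (B ⊕ (Fin m × β))) (s : Fin m → ℚ), StrictMono s →
        (∀ᶠ t in (iterLim U (List.ofFn fun i : Fin m => i) 0 : Filter (Fin m → ℕ)),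
          φ.Realize (Sum.elim (↑) fun z : Fin m × β => y (t z.1) z.2)) →
        φ.Realize (Sum.elim (↑) fun z : Fin m × β => x (s z.1, z.2)) := by
      intro φ s hs h
      have hrel : ∀ f : ℚ × β → M,
          (φ.relabel (Sum.map id (Prod.map s id))).Realize (Sum.elim (↑) f) ↔
            φ.Realize (Sum.elim (↑) fun z : Fin m × β => f (s z.1, z.2)) := by
        intro f
        rw [Formula.realize_relabel]
        have : (Sum.elim (fun b : B => (b : M)) f ∘ Sum.map id (Prod.map s id)) =
            Sum.elim (↑) fun z : Fin m × β => f (s z.1, z.2) := by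
          ext (b | z) <;> rfl
        rw [this]
      refine (hrel x).1 (hx _ ?_)
      filter_upwards [Filter.eventually_ge_atTop (Finset.univ.image s)] with R hR
      simp only [hrel]
      exact (eventually_iterLim_sort hs
        (fun i => hR (Finset.mem_image_of_mem _ (Finset.mem_univ i))) 0 0 fun t =>
          φ.Realize (Sum.elim (↑) fun z : Fin m × β => y (t z.1) z.2)).2 h
    intro φ s hs
    refine ⟨fun h => ?_, h1 φ s hs⟩
    by_contra hn
    rw [← Ultrafilter.eventually_not] at hn
    exact Formula.realize_not.1 (h1 (∼φ) s hs (hn.mono fun t ht => Formula.realize_not.2 ht)) h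
  refine ⟨fun q b => x (q, b), fun m s t hs ht => ?_, fun m φ h s hs => ?_⟩
  · obtain ⟨σ, hσ, h⟩ := hom.exists_fixingAut hκ.le hB
      (x := fun z : Fin m × β => x (s z.1, z.2)) (y := fun z : Fin m × β => x (t z.1, z.2))
      (mk_range_prod_lt hκ hβ _) fun φ => (key m φ s hs).trans (key m φ t ht).symm
    exact ⟨σ, hσ, fun k => funext fun b => h (k, b)⟩
  · exact (key m φ s hs).2 ((eventually_iterLim_strictMono m 0).mono fun t ht => h t ht)

/-- If all increasing tuples of `y` are conjugate to `x` in the coordinates `g`, then so are the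
increasing tuples of a sequence that satisfies all formulas common to these tuples. -/
theorem exists_fixingAut_of_forall_formula (hom : IsStronglyHomogeneous L M κ)
    (hκ : ℵ₀ < κ) {B : Set M} (hB : #B < κ) {β γ : Type w} (hγ : #γ < κ) {m : ℕ}
    {y : ℕ → β → M} {y' : ℚ → β → M}
    (hyy : ∀ φ : L.Formula (B ⊕ (Fin m × β)),
        (∀ t : Fin m → ℕ, StrictMono t →
          φ.Realize (Sum.elim (↑) fun z : Fin m × β => y (t z.1) z.2)) →
        ∀ s : Fin m → ℚ, StrictMono s →
          φ.Realize (Sum.elim (↑) fun z : Fin m × β => y' (s z.1) z.2))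
    {B' : Set M} (hB' : B' ⊆ B)
    (g : γ → Fin m × β) (x : γ → M)
    (h : ∀ t : Fin m → ℕ, StrictMono t →
      ∃ σ ∈ fixingAut L B', ∀ c, σ (x c) = y (t (g c).1) (g c).2)
    (s : Fin m → ℚ) (hs : StrictMono s) :
    ∃ σ ∈ fixingAut L B', ∀ c, σ (x c) = y' (s (g c).1) (g c).2 := by
  have h1 : ∀ φ : L.Formula (B' ⊕ γ), φ.Realize (Sum.elim (↑) x) →
      φ.Realize (Sum.elim (↑) fun c => y' (s (g c).1) (g c).2) := by
    intro φ hφ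
    have hrel : ∀ f : Fin m × β → M,
        (φ.relabel (Sum.map (Set.inclusion hB') g)).Realize (Sum.elim (↑) f) ↔
          φ.Realize (Sum.elim (↑) fun c => f (g c)) := by
      intro f
      rw [Formula.realize_relabel]
      have : (Sum.elim (fun b : B => (b : M)) f ∘ Sum.map (Set.inclusion hB') g) =
          Sum.elim (↑) fun c => f (g c) := by
        ext (b | z) <;> rfl
      rw [this]
    refine (hrel _).1 (hyy _ (fun t ht => (hrel _).2 ?_) s hs)
    obtain ⟨σ, hσ, e⟩ := h t ht
    exact (realize_iff_of_fixingAut hσ φ e).1 hφ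
  refine hom.exists_fixingAut hκ.le ((Cardinal.mk_le_mk_of_subset hB').trans_lt hB)
    (Cardinal.mk_range_le.trans_lt hγ) fun φ => ⟨h1 φ, fun h2 => ?_⟩
  by_contra hn
  exact Formula.realize_not.1 (h1 (∼φ) (Formula.realize_not.2 hn)) h2

end Indiscernible

/-! ### Conjugates of H, and stable quotients along indiscernible sequences -/

section DefinableGroup

variable {L : Language.{u, v}} {M : Type w} [L.Structure M]

theorem comp_mem_solutionSet {α ι : Type*} {p : Set (L.Formula (α ⊕ ι))} (σ : M ≃[L] M)
    {a : ι → M} {x : α → M} : σ ∘ x ∈ solutionSet p (σ ∘ a) ↔ x ∈ solutionSet p a := by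
  refine forall₂_congr fun φ _ => ?_
  rw [← Sum.comp_elim, StrongHomClass.realize_formula]

namespace DefinableGroup

variable {G : Type z} [Group G] (D : DefinableGroup L M G)

theorem comp_mem_dom (σ : M ≃[L] M) {x : Fin D.n → M} (hx : x ∈ D.dom) : σ ∘ x ∈ D.dom :=
  comp_mem_of_empty_definable D.dom_definable σ hx

theorem act_symm_act (σ : M ≃[L] M) (g : G) : D.act σ.symm (D.act σ g) = g := by
  obtain ⟨x, hx, rfl⟩ := D.surj g
  rw [D.act_proj _ hx, D.act_proj _ (D.comp_mem_dom _ hx)]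
  congr 1
  ext i
  exact Equiv.symm_apply_apply σ (x i)

theorem act_act_symm (σ : M ≃[L] M) (g : G) : D.act σ (D.act σ.symm g) = g := by
  obtain ⟨x, hx, rfl⟩ := D.surj g
  rw [D.act_proj _ hx, D.act_proj _ (D.comp_mem_dom _ hx)]
  congr 1
  ext i
  exact Equiv.apply_symm_apply σ (x i)

theorem mem_map_act {H : Subgroup G} {σ : M ≃[L] M} {g : G} :
    g ∈ H.map (D.act σ) ↔ D.act σ.symm g ∈ H := by
  constructor
  · rintro ⟨h, hh, rfl⟩
    rwa [D.act_symm_act]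
  · exact fun h => ⟨_, h, D.act_act_symm σ g⟩

variable {D} {ι : Type*} {H : Subgroup G} {p : Set (L.Formula (Fin D.n ⊕ ι))} {a : ι → M}

theorem IsTypeDefinedBy.map_act (h : D.IsTypeDefinedBy H p a) (σ : M ≃[L] M) :
    D.IsTypeDefinedBy (H.map (D.act σ)) p (σ ∘ a) := by
  ext x
  have e : σ ∘ (σ.symm ∘ x) = x := funext fun i => Equiv.apply_symm_apply σ (x i)
  rw [← e, comp_mem_solutionSet, ← h, e]
  have h1 : x ∈ D.dom ↔ σ.symm ∘ x ∈ D.dom :=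
    ⟨fun hx => D.comp_mem_dom _ hx, fun hx => e ▸ D.comp_mem_dom σ hx⟩
  simp only [Set.mem_ofPred_eq, ← h1, mem_map_act]
  exact and_congr_right fun hx => by rw [D.act_proj _ hx]

theorem IsTypeDefinedBy.mem_dom (h : D.IsTypeDefinedBy H p a) {x : Fin D.n → M}
    (hx : x ∈ solutionSet p a) : x ∈ D.dom := by
  rw [← h] at hx
  exact hx.1

theorem IsTypeDefinedBy.proj_mem (h : D.IsTypeDefinedBy H p a) {x : Fin D.n → M}
    (hx : x ∈ solutionSet p a) : D.proj x ∈ H := by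
  rw [← h] at hx
  exact hx.2

theorem IsTypeDefinedBy.mem_solutionSet (h : D.IsTypeDefinedBy H p a) {x : Fin D.n → M}
    (hx : x ∈ D.dom) (hxH : D.proj x ∈ H) : x ∈ solutionSet p a := by
  rw [← h]
  exact ⟨hx, hxH⟩

theorem IsTypeDefinedBy.act_mem {H' : Subgroup G} {a' : ι → M} (h : D.IsTypeDefinedBy H p a)
    (h' : D.IsTypeDefinedBy H' p a') {σ : M ≃[L] M} (hσ : σ ∘ a = a') {g : G} (hg : g ∈ H) :
    D.act σ g ∈ H' := by
  obtain ⟨x, hx, rfl⟩ := D.surj g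
  rw [D.act_proj _ hx]
  refine h'.proj_mem ?_
  rw [← hσ, comp_mem_solutionSet]
  exact h.mem_solutionSet hx hg

variable (D)

/-- Two tuples represent elements of the same left coset of `H`. -/
def SameCoset (H : Subgroup G) (x y : Fin D.n → M) : Prop :=
  (D.proj x)⁻¹ * D.proj y ∈ H

/-- The subgroup `H` is invariant under the automorphisms over `B`. -/
def IsInvariantOver (H : Subgroup G) (B : Set M) : Prop :=
  ∀ σ ∈ fixingAut L B, ∀ g ∈ H, D.act σ g ∈ H

variable {D} {B : Set M} {κ : Cardinal.{w}}

theorem SameCoset.symm {x y : Fin D.n → M} (h : D.SameCoset H x y) : D.SameCoset H y x := by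
  have := H.inv_mem h
  rwa [mul_inv_rev, inv_inv] at this

theorem SameCoset.trans {x y t : Fin D.n → M} (h : D.SameCoset H x y) (h' : D.SameCoset H y t) :
    D.SameCoset H x t := by
  have := H.mul_mem h h'
  rwa [mul_assoc, mul_inv_cancel_left] at this

theorem SameCoset.comp (hH : D.IsInvariantOver H B) {σ : M ≃[L] M} (hσ : σ ∈ fixingAut L B)
    {x y : Fin D.n → M} (hx : x ∈ D.dom) (hy : y ∈ D.dom) (h : D.SameCoset H x y) :
    D.SameCoset H (σ ∘ x) (σ ∘ y) := by
  have := hH σ hσ _ h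
  rwa [map_mul, map_inv, D.act_proj σ hx, D.act_proj σ hy] at this

theorem IsTypeDefinedBy.isInvariantOver (h : D.IsTypeDefinedBy H p a) (ha : Set.range a ⊆ B) :
    D.IsInvariantOver H B := fun _ hσ _ hg =>
  h.act_mem h (funext fun i => hσ _ (ha ⟨i, rfl⟩)) hg

theorem IsInvariantOver.mono {C : Set M} (h : D.IsInvariantOver H B) (hBC : B ⊆ C) :
    D.IsInvariantOver H C := fun σ hσ => h σ (fixingAut_mono hBC hσ)

theorem IsInvariantOver.inf {H' : Subgroup G} (h : D.IsInvariantOver H B)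
    (h' : D.IsInvariantOver H' B) : D.IsInvariantOver (H ⊓ H') B :=
  fun σ hσ g hg => ⟨h σ hσ g hg.1, h' σ hσ g hg.2⟩

variable (D κ) in
/-- Stability of `G/H` over `B`, for indiscernible sequences of real tuples. -/
def IsSeqStable (H : Subgroup G) (B : Set M) : Prop :=
  ∀ (β : Type w), #β < κ → ∀ (y : ℚ → β → M) (r : Fin D.n → β), (∀ i, y i ∘ r ∈ D.dom) →
    IsIndiscernible L B y →
    ∃ σ ∈ fixingAut L B, D.SameCoset H (σ ∘ y 0 ∘ r) (y 1 ∘ r) ∧ σ ∘ y 1 = y 0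

theorem IsStableQuotient.isSeqStable (h : D.IsStableQuotient κ H B) (hH : D.IsInvariantOver H B) :
    D.IsSeqStable κ H B := by
  intro β hβ y r hr hy
  obtain ⟨σ, hσ, ⟨g, hg, hg'⟩, h1⟩ := h β hβ (fun i => (D.proj (y i ∘ r) : G ⧸ H))
    (fun i => y i) (fun m s t hs ht => by
      obtain ⟨σ, hσ, e⟩ := hy m (fun k => (s k : ℚ)) (fun k => (t k : ℚ))
        (fun i j hij => Nat.cast_lt.2 (hs hij)) (fun i j hij => Nat.cast_lt.2 (ht hij))
      refine ⟨σ, hσ, fun k => ⟨⟨_, rfl, ?_⟩, e k⟩⟩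
      rw [D.act_proj σ (hr _), ← Function.comp_assoc, e k]) 0 1 zero_ne_one
  refine ⟨σ, hσ, ?_, by simpa using h1⟩
  rw [QuotientGroup.eq] at hg hg'
  -- `MapsCoset` supplies some representative `g` of the first coset; invariance of `H` replaces it
  -- by the given one.
  have h2 := hH σ hσ _ (H.inv_mem hg)
  rw [mul_inv_rev, inv_inv, map_mul, map_inv, D.act_proj σ (hr _)] at h2
  have h3 := H.mul_mem h2 hg'
  rw [mul_assoc, mul_inv_cancel_left] at h3
  simpa [SameCoset] using h3

theorem IsSeqStable.map_act (h : D.IsSeqStable κ H B) (τ : M ≃[L] M) :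
    D.IsSeqStable κ (H.map (D.act τ)) (τ '' B) := by
  have hconj : ∀ σ ∈ fixingAut L (τ '' B), τ.symm.comp (σ.comp τ) ∈ fixingAut L B := by
    intro σ hσ x hx
    simp only [Equiv.comp_apply, hσ _ (Set.mem_image_of_mem τ hx), Equiv.symm_apply_apply]
  intro β hβ y r hr hy
  obtain ⟨σ, hσ, h1, h2⟩ := h β hβ (fun i => τ.symm ∘ y i) r
    (fun i => D.comp_mem_dom τ.symm (hr i)) (fun m s t hs ht => by
      obtain ⟨σ, hσ, e⟩ := hy m s t hs ht
      refine ⟨_, hconj σ hσ, fun k => ?_⟩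
      ext b
      have := congrFun (e k) b
      simp only [Function.comp_apply] at this
      simp [Equiv.comp_apply, Equiv.apply_symm_apply, this])
  refine ⟨τ.comp (σ.comp τ.symm), ?_, ?_, ?_⟩
  · rintro _ ⟨x, hx, rfl⟩
    simp only [Equiv.comp_apply, Equiv.symm_apply_apply, hσ x hx]
  · rw [SameCoset, mem_map_act, map_mul, map_inv,
      D.act_proj _ (D.comp_mem_dom _ (hr 0)), D.act_proj _ (hr 1)]
    have e : τ.symm ∘ (τ.comp (σ.comp τ.symm)) ∘ y 0 ∘ r = σ ∘ (τ.symm ∘ y 0) ∘ r := by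
      ext i
      simp [Equiv.comp_apply, Equiv.symm_apply_apply]
    rw [e]
    exact h1
  · ext b
    have := congrFun h2 b
    simp only [Function.comp_apply] at this
    simp [Equiv.comp_apply, this, Equiv.apply_symm_apply]

theorem isSeqStable_top : D.IsSeqStable κ ⊤ B := by
  intro β hβ y r hr hy
  obtain ⟨σ, hσ, e⟩ := hy 1 (fun _ => 1) (fun _ => 0) (Subsingleton.strictMono _)
    (Subsingleton.strictMono _)
  exact ⟨σ, hσ, Subgroup.mem_top _, e 0⟩

/-- The new parameters are appended to every tuple as constant coordinates, so that an automorphism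
exchanging tuples must fix them. -/
theorem IsSeqStable.mono (h : D.IsSeqStable κ H B) (hκ : ℵ₀ ≤ κ) {C : Set M} (hBC : B ⊆ C)
    (hC : #C < κ) : D.IsSeqStable κ H C := by
  intro β hβ y r hr hy
  obtain ⟨σ, hσ, h1, h2⟩ := h (β ⊕ C) (by
      rw [Cardinal.mk_sum, Cardinal.lift_id, Cardinal.lift_id]
      exact Cardinal.add_lt_of_lt hκ hβ hC)
    (fun i => Sum.elim (y i) (↑)) (Sum.inl ∘ r) hr (fun m s t hs ht => by
      obtain ⟨σ, hσ, e⟩ := hy m s t hs ht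
      refine ⟨σ, fixingAut_mono hBC hσ, fun k => ?_⟩
      rw [Sum.comp_elim, e k]
      congr 1
      exact funext fun c => hσ _ c.2)
  rw [Sum.comp_elim] at h2
  refine ⟨σ, fun c hc => congrFun h2 (Sum.inr ⟨c, hc⟩), h1, ?_⟩
  ext b
  exact congrFun h2 (Sum.inl b)

/-- In an indiscernible sequence, the type of a coset represented by an element of the sequence
over other elements of the sequence does not depend on its position. -/
theorem IsSeqStable.exists_shift (h : D.IsSeqStable κ H B) (hH : D.IsInvariantOver H B)
    (hom : IsStronglyHomogeneous L M κ) (hκ : ℵ₀ < κ) (hB : #B < κ)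
    {I : Type} [LinearOrder I] [Countable I] [DenselyOrdered I] {β : Type w} (hβ : #β < κ)
    {y : I → β → M} {r : Fin D.n → β} (hr : ∀ i, y i ∘ r ∈ D.dom) (hy : IsIndiscernible L B y)
    {s s' : I} (hs : s < s') {F P : Set I} (hF : F ⊆ Set.Ioo s s')
    (hP : ∀ i ∈ P, i < s ∨ s' < i) :
    ∃ σ ∈ fixingAut L B, D.SameCoset H (σ ∘ y s ∘ r) (y s' ∘ r) ∧ ∀ i ∈ F ∪ P, σ ∘ y i = y i := by
  classical
  have conj : ∀ (K : Type) [Countable K] (f g : K → I), (∀ k, f k ∈ Set.Icc s s') →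
      (∀ k, g k ∈ Set.Icc s s') → (∀ k l, f k < f l ↔ g k < g l) →
      ∃ σ ∈ fixingAut L B, (∀ k, σ ∘ y (f k) = y (g k)) ∧ ∀ i ∈ P, σ ∘ y i = y i := by
    intro K _ f g hf hg hfg
    have h1 : ∀ i ∈ P, ∀ x ∈ Set.Icc s s', (x < i ↔ s' < i) := by
      refine fun i hi x hx => ⟨fun hxi => ?_, fun h => hx.2.trans_lt h⟩
      exact (hP i hi).resolve_left fun h => (h.trans_le hx.1).not_gt hxi
    have h2 : ∀ i ∈ P, ∀ x ∈ Set.Icc s s', (i < x ↔ i < s) := by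
      refine fun i hi x hx => ⟨fun hxi => ?_, fun h => h.trans_le hx.1⟩
      exact (hP i hi).resolve_right fun h => (hx.2.trans_lt h).not_gt hxi
    obtain ⟨σ, hσ, e⟩ := hy.exists_fixingAut hom hκ hB hβ (J := K ⊕ P) (Sum.elim f (↑))
      (Sum.elim g (↑)) (by
        rintro (k | i) (l | j)
        · exact hfg k l
        · exact (h1 j j.2 _ (hf k)).trans (h1 j j.2 _ (hg k)).symm
        · exact (h2 i i.2 _ (hf l)).trans (h2 i i.2 _ (hg l)).symm
        · exact Iff.rfl)
    exact ⟨σ, hσ, fun k => e (Sum.inl k), fun i hi => e (Sum.inr ⟨i, hi⟩)⟩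
  have : Nontrivial (Set.Ioo s s') := by
    obtain ⟨a, ha, ha'⟩ := exists_between hs
    obtain ⟨b, hb, hb'⟩ := exists_between ha
    exact ⟨⟨⟨a, ha, ha'⟩, ⟨b, hb, hb'.trans ha'⟩, fun e => hb'.ne' (congrArg Subtype.val e)⟩⟩
  have : Countable (ℚ ×ₗ WithBot F) :=
    inferInstanceAs (Countable (ℚ × Option F))
  have : Countable (WithBot F) := inferInstanceAs (Countable (Option F))
  obtain ⟨E⟩ := Order.embedding_from_countable_to_dense (ℚ ×ₗ WithBot F) (Set.Ioo s s')
  -- Inside the interval, place ℚ many consecutive blocks: the bottom index of a block plays the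
  -- role of the moving coset, the others form a copy of `F`. The blocks are indiscernible over
  -- `B'`, so stability exchanges coset and copy between blocks 0 and 1.
  let e : ℚ → WithBot F → I := fun q f => E (toLex (q, f))
  have he : ∀ q f, e q f ∈ Set.Icc s s' := fun q f => Set.Ioo_subset_Icc_self (E _).2
  have hlt : ∀ q f q' f', e q f < e q' f' ↔ q < q' ∨ q = q' ∧ f < f' := by
    intro q f q' f'
    rw [← Prod.Lex.toLex_lt_toLex (x := (q, f)) (y := (q', f')), ← E.lt_iff_lt]
    rfl
  let B' : Set M := B ∪ Set.range fun c : P × β => y c.1 c.2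
  have hBB' : B ⊆ B' := Set.subset_union_left
  have hB' : #B' < κ := (Cardinal.mk_union_le _ _).trans_lt
    (Cardinal.add_lt_of_lt hκ.le hB (mk_range_prod_lt hκ hβ _))
  have hfix : ∀ σ ∈ fixingAut L B, (∀ i ∈ P, σ ∘ y i = y i) → σ ∈ fixingAut L B' := by
    rintro σ hσ h1 x (hx | ⟨c, rfl⟩)
    · exact hσ x hx
    · exact congrFun (h1 c.1 c.1.2) c.2
  obtain ⟨σ, hσ, h1, h2⟩ := h.mono hκ.le hBB' hB' (WithBot F × β) (mk_prod_lt_of_countable hκ hβ)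
    (fun q c => y (e q c.1) c.2) (fun i => (⊥, r i)) (fun i => hr (e i ⊥)) (fun m f g hf hg => by
      obtain ⟨σ, hσ, h1, h2⟩ := conj (Fin m × WithBot F) (fun k => e (f k.1) k.2)
        (fun k => e (g k.1) k.2) (fun k => he _ _) (fun k => he _ _) (fun k l => by
          rw [hlt, hlt, hf.lt_iff_lt, hg.lt_iff_lt, hf.injective.eq_iff, hg.injective.eq_iff])
      exact ⟨σ, hfix σ hσ h2, fun k => funext fun c => congrFun (h1 (k, c.1)) c.2⟩)
  -- `s` lies below `F`, as the bottom of block 0 lies below the copy in block 1.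
  obtain ⟨τ, hτ, hτ1, hτ2⟩ := conj (Option F) (fun k => k.elim s (↑))
    (fun k => k.elim (e 0 ⊥) fun f => e 1 f)
    (by rintro (_ | f); exacts [⟨le_rfl, hs.le⟩, Set.Ioo_subset_Icc_self (hF f.2)])
    (by rintro (_ | f); exacts [he _ _, he _ _]) (by
      rintro (_ | f) (_ | f')
      · simp
      · simp [hlt, (hF f'.2).1]
      · exact iff_of_false (hF f.2).1.not_gt (by norm_num [hlt])
      · simp [hlt])
  -- After the exchange the coset sits above the copy of `F` in block 0, just as `s'` lies above
  -- `F`.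
  obtain ⟨ρ, hρ, hρ1, hρ2⟩ := conj (Option F) (fun k => k.elim (e 1 ⊥) fun f => e 0 f)
    (fun k => k.elim s' (↑)) (by rintro (_ | f); exacts [he _ _, he _ _])
    (by rintro (_ | f); exacts [⟨hs.le, le_rfl⟩, Set.Ioo_subset_Icc_self (hF f.2)]) (by
      rintro (_ | f) (_ | f')
      · simp
      · exact iff_of_false (by norm_num [hlt]) (hF f'.2).2.not_gt
      · simp [hlt, (hF f.2).2]
      · simp [hlt])
  have hσB := fixingAut_mono hBB' hσ
  refine ⟨ρ.comp (σ.comp τ), fixingAut_comp hρ (fixingAut_comp hσB hτ), ?_, ?_⟩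
  · have e1 : (ρ.comp (σ.comp τ)) ∘ y s ∘ r = ρ ∘ σ ∘ y (e 0 ⊥) ∘ r := by
      ext i
      exact congrArg (fun t => ρ (σ t)) (congrFun (hτ1 none) (r i))
    have e2 : y s' ∘ r = ρ ∘ y (e 1 ⊥) ∘ r := by
      ext i
      exact (congrFun (hρ1 none) (r i)).symm
    rw [e1, e2]
    exact SameCoset.comp hH hρ (D.comp_mem_dom σ (hr _)) (hr _) h1
  · rintro i (hi | hi)
    · ext b
      have a1 := congrFun (hτ1 (some ⟨i, hi⟩)) b
      have a2 := congrFun h2 ((⟨i, hi⟩ : F), b)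
      have a3 := congrFun (hρ1 (some ⟨i, hi⟩)) b
      simp only [Function.comp_apply, Option.elim_some] at a1 a2 a3
      simp only [Function.comp_apply, Equiv.comp_apply]
      rw [a1, a2, a3]
    · ext b
      have a1 := congrFun (hτ2 i hi) b
      have a2 := hσ (y i b) (Or.inr ⟨(⟨i, hi⟩, b), rfl⟩)
      have a3 := congrFun (hρ2 i hi) b
      simp only [Function.comp_apply] at a1 a2 a3
      simp only [Function.comp_apply, Equiv.comp_apply]
      rw [a1, a2, a3]

end DefinableGroup

end DefinableGroup

/-! ### Intersections of subgroups with stable quotients -/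

section DefinableGroup

variable {L : Language.{u, v}} {M : Type w} [L.Structure M]

namespace DefinableGroup

variable {G : Type z} [Group G] {D : DefinableGroup L M G} {ι : Type*} {H : Subgroup G}
  {p : Set (L.Formula (Fin D.n ⊕ ι))} {a : ι → M} {B : Set M} {κ : Cardinal.{w}}

variable (D) in
theorem exists_formula_mul : ∃ φ : L.Formula (Fin 3 × Fin D.n), ∀ x y t : Fin D.n → M,
    φ.Realize (fun c => ![x, y, t] c.1 c.2) ↔
      (x ∈ D.dom ∧ y ∈ D.dom ∧ t ∈ D.dom) ∧ D.proj x * D.proj y = D.proj t := by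
  obtain ⟨φ, hφ⟩ := Set.empty_definable_iff.1 D.mul_definable
  refine ⟨φ, fun x y t => ?_⟩
  refine (Set.ext_iff.1 hφ fun c => ![x, y, t] c.1 c.2).symm.trans (and_congr ?_ Iff.rfl)
  rw [Fin.forall_fin_succ, Fin.forall_fin_succ, Fin.forall_fin_succ]
  simp only [IsEmpty.forall_iff, and_true]
  exact Iff.rfl

/-- The quotient by the intersection of two subgroups with stable quotients is stable. -/
theorem IsSeqStable.inf [Nonempty M] (h : D.IsSeqStable κ H B) (hp : D.IsTypeDefinedBy H p a)
    (ha : Set.range a ⊆ B) {H' : Subgroup G} (h' : D.IsSeqStable κ H' B)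
    (hH' : D.IsInvariantOver H' B) (sat : IsSaturated L M κ)
    (hom : IsStronglyHomogeneous L M κ) (hκ : ℵ₀ < κ) (hB : #B < κ) :
    D.IsSeqStable κ (H ⊓ H') B := by
  classical
  have hH := hp.isInvariantOver ha
  intro β hβ y r hr hy
  -- Stability of `G/H` moves each later representative into the `H`-coset of the initial one while
  -- fixing the other tuples of the sequence.
  have shift : ∀ n : ℕ, ∃ σ ∈ fixingAut L B, D.SameCoset H (y 0 ∘ r) (σ ∘ y (n + 1) ∘ r) ∧
      ∀ k : ℕ, k ≠ n → σ ∘ y (k + 1) = y (k + 1) := by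
    intro n
    obtain ⟨σ, hσ, h1, h2⟩ := h.exists_shift hH hom hκ hB hβ hr hy (s := 0) (s' := n + 1)
      (by positivity) (F := {i | ∃ k : ℕ, k < n ∧ i = k + 1})
      (P := {i | ∃ k : ℕ, n < k ∧ i = k + 1}) (by
        rintro _ ⟨k, hk, rfl⟩
        exact ⟨by positivity, by exact_mod_cast Nat.succ_lt_succ hk⟩) (by
        rintro _ ⟨k, hk, rfl⟩
        exact Or.inr (by exact_mod_cast Nat.succ_lt_succ hk))
    have hsymm : ∀ x : β → M, σ.symm ∘ σ ∘ x = x := fun x =>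
      funext fun b => Equiv.symm_apply_apply σ (x b)
    refine ⟨σ.symm, fixingAut_symm hσ, ?_, fun k hk => ?_⟩
    · have := SameCoset.comp hH (fixingAut_symm hσ) (D.comp_mem_dom _ (hr _)) (hr _) h1
      have e : σ.symm ∘ σ ∘ y 0 ∘ r = y 0 ∘ r := congrArg (· ∘ r) (hsymm (y 0))
      rwa [e] at this
    · rw [← h2 (k + 1) (by
        rcases hk.lt_or_gt with hk | hk
        exacts [Or.inl ⟨k, hk, rfl⟩, Or.inr ⟨k, hk, rfl⟩]), hsymm]
      exact (h2 (k + 1) (by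
        rcases hk.lt_or_gt with hk | hk
        exacts [Or.inl ⟨k, hk, rfl⟩, Or.inr ⟨k, hk, rfl⟩])).symm
  choose τ hτ hτcos hτfix using shift
  choose W hWdom hW using fun n : ℕ =>
    D.surj ((D.proj (y 0 ∘ r))⁻¹ * D.proj (τ n ∘ y (n + 1) ∘ r))
  let β' := (Fin D.n ⊕ Fin D.n) ⊕ β
  have hβ' : #β' < κ := by
    simp only [β', Cardinal.mk_sum, Cardinal.lift_id, Cardinal.lift_add, Cardinal.mk_fin,
      Cardinal.lift_natCast, Cardinal.lift_id']
    have hn : (D.n : Cardinal.{w}) < κ := (Cardinal.natCast_lt_aleph0).trans hκ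
    exact Cardinal.add_lt_of_lt hκ.le (Cardinal.add_lt_of_lt hκ.le hn hn) (by simpa using hβ)
  let C : Set M := B ∪ Set.range (y 0 ∘ r)
  have hBC : B ⊆ C := Set.subset_union_left
  have hC : #C < κ := (Cardinal.mk_union_le _ _).trans_lt (Cardinal.add_lt_of_lt hκ.le hB
    ((Cardinal.mk_lt_aleph0_iff.2 (Set.finite_range _).to_subtype).trans hκ))
  -- The quotient `W n`, an element of `H`, is kept in the tuple so that lying in the fixed
  -- `H`-coset is expressed by `p` and the multiplication formula, and hence survives the passage to
  -- `Z`.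
  let Y : ℕ → β' → M := fun n =>
    Sum.elim (Sum.elim (τ n ∘ y (n + 1) ∘ r) (W n)) (y (n + 1))
  obtain ⟨Z, hZ, hEM⟩ := exists_isIndiscernible sat hom hκ hC hβ' Y
  let ry : Fin D.n → β' := fun i => Sum.inl (Sum.inl i)
  let rz : Fin D.n → β' := fun i => Sum.inl (Sum.inr i)
  have hWp : ∀ q, Z q ∘ rz ∈ solutionSet p a := by
    intro q φ hφ
    have hrel : ∀ f : Fin 1 × β' → M, (φ.relabel (Sum.elim (fun i => Sum.inr (0, rz i))
        (fun j => Sum.inl ⟨a j, hBC (ha ⟨j, rfl⟩)⟩)) : L.Formula (C ⊕ (Fin 1 × β'))).Realize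
          (Sum.elim (↑) f) ↔ φ.Realize (Sum.elim (fun i => f (0, rz i)) a) := by
      intro f
      rw [Formula.realize_relabel]
      have : (Sum.elim (fun c : C => (c : M)) f ∘ (Sum.elim (fun i => Sum.inr (0, rz i))
        (fun j => Sum.inl ⟨a j, hBC (ha ⟨j, rfl⟩)⟩))) = Sum.elim (fun i => f (0, rz i)) a := by
        ext (i | j) <;> rfl
      rw [this]
    refine (hrel _).1 (hEM 1 _ (fun t ht => (hrel _).2 ?_) (fun _ => q)
      (Subsingleton.strictMono _))
    exact hp.mem_solutionSet (hWdom (t 0)) ((hW (t 0)).symm ▸ hτcos (t 0)) φ hφ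
  have hmul : ∀ q, (y 0 ∘ r ∈ D.dom ∧ Z q ∘ rz ∈ D.dom ∧ Z q ∘ ry ∈ D.dom) ∧
      D.proj (y 0 ∘ r) * D.proj (Z q ∘ rz) = D.proj (Z q ∘ ry) := by
    intro q
    obtain ⟨φ, hφ⟩ := D.exists_formula_mul
    have hrel : ∀ f : Fin 1 × β' → M, (φ.relabel (fun c : Fin 3 × Fin D.n =>
        ![fun i => Sum.inl ⟨y 0 (r i), Or.inr ⟨i, rfl⟩⟩, fun i => Sum.inr (0, rz i),
          fun i => Sum.inr (0, ry i)] c.1 c.2) : L.Formula (C ⊕ (Fin 1 × β'))).Realize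
          (Sum.elim (↑) f) ↔ φ.Realize (fun c : Fin 3 × Fin D.n =>
            ![y 0 ∘ r, fun i => f (0, rz i), fun i => f (0, ry i)] c.1 c.2) := by
      intro f
      rw [Formula.realize_relabel]
      have : (Sum.elim (fun c : C => (c : M)) f ∘ (fun c : Fin 3 × Fin D.n =>
        ![fun i => Sum.inl ⟨y 0 (r i), Or.inr ⟨i, rfl⟩⟩, fun i => Sum.inr (0, rz i),
          fun i => Sum.inr (0, ry i)] c.1 c.2)) = (fun c : Fin 3 × Fin D.n =>
            ![y 0 ∘ r, fun i => f (0, rz i), fun i => f (0, ry i)] c.1 c.2) := by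
        ext ⟨k, i⟩
        fin_cases k <;> rfl
      rw [this]
    refine (hφ _ _ _).1 ((hrel _).1 (hEM 1 _ (fun t ht => (hrel _).2 ((hφ _ _ _).2
      ⟨⟨hr 0, hWdom (t 0), D.comp_mem_dom (τ (t 0)) (hr (t 0 + 1))⟩, ?_⟩))
        (fun _ => q) (Subsingleton.strictMono _)))
    refine (congrArg (D.proj (y 0 ∘ r) * ·) (hW (t 0))).trans ?_
    rw [mul_inv_cancel_left]
    rfl
  have hcos : ∀ q, D.SameCoset H (y 0 ∘ r) (Z q ∘ ry) := by
    intro q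
    rw [SameCoset, ← (hmul q).2, inv_mul_cancel_left]
    exact hp.proj_mem (hWp q)
  have hcard : #(Fin D.n ⊕ β) < κ := by
    rw [Cardinal.mk_sum, Cardinal.mk_fin, Cardinal.lift_natCast]
    exact Cardinal.add_lt_of_lt hκ.le (Cardinal.natCast_lt_aleph0.trans hκ) (by simpa using hβ)
  -- Moving a representative may change its relation to its own tuple, but not to the others, and
  -- stability only concerns pairs with distinct indices.
  have hpair : ∀ (i j : Fin 2), i ≠ j → ∃ σ ∈ fixingAut L B,
      σ ∘ y (i : ℕ) ∘ r = Z (i : ℕ) ∘ ry ∧ σ ∘ y (j : ℕ) = Z (j : ℕ) ∘ Sum.inr := by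
    intro i j hij
    obtain ⟨σ, hσ, e⟩ := exists_fixingAut_of_forall_formula (y := Y) (y' := Z) hom
      hκ hC hcard (hEM 2) hBC
      (Sum.elim (fun k => (i, ry k)) (fun b => (j, Sum.inr b)))
      (Sum.elim (y (i : ℕ) ∘ r) (y (j : ℕ))) (fun t ht => by
        obtain ⟨σ, hσ, e⟩ := hy 2 (fun k => ((k : ℕ) : ℚ)) (fun k => (t k : ℚ) + 1)
          (fun k l hkl => Nat.cast_lt.2 hkl) (fun k l hkl => by
            have := ht hkl
            dsimp only
            gcongr)
        refine ⟨(τ (t i)).comp σ, fixingAut_comp (hτ _) hσ, ?_⟩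
        rintro (k | b)
        · exact congrArg (τ (t i)) (congrFun (e i) (r k))
        · refine (congrArg (τ (t i)) (congrFun (e j) b)).trans ?_
          exact congrFun (hτfix (t i) (t j) fun h => hij (ht.injective h).symm) b)
      (fun k => ((k : ℕ) : ℚ)) (fun k l hkl => Nat.cast_lt.2 hkl)
    exact ⟨σ, hσ, funext fun k => e (Sum.inl k), funext fun b => e (Sum.inr b)⟩
  obtain ⟨ρ, hρ, hρ1, hρ2⟩ := hpair 0 1 (by decide)
  obtain ⟨ν, hν, hν1, hν2⟩ := hpair 1 0 (by decide)
  simp only [Fin.val_zero, Fin.val_one, Nat.cast_zero, Nat.cast_one] at hρ1 hρ2 hν1 hν2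
  obtain ⟨σ, hσ, hσ1, hσ2⟩ := h'.mono hκ.le hBC hC β' hβ' Z ry (fun q => (hmul q).1.2.2) hZ
  have hσB := fixingAut_mono hBC hσ
  -- All representatives in `Z` lie in one `H`-coset with a representative fixed by `σ`, so the
  -- automorphism given by stability of `G/H'` also respects `H`.
  have hσH : D.SameCoset H (σ ∘ Z 0 ∘ ry) (Z 1 ∘ ry) := by
    have h1 := SameCoset.comp hH hσB (hr 0) (hmul 0).1.2.2 (hcos 0)
    have e : σ ∘ y 0 ∘ r = y 0 ∘ r := funext fun i => hσ _ (Or.inr ⟨i, rfl⟩)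
    rw [e] at h1
    exact h1.symm.trans (hcos 1)
  have hνs : ∀ {δ : Type w} (x : δ → M), ν.symm ∘ ν ∘ x = x := fun x =>
    funext fun b => Equiv.symm_apply_apply ν (x b)
  refine ⟨ν.symm.comp (σ.comp ρ), fixingAut_comp (fixingAut_symm hν) (fixingAut_comp hσB hρ),
    ?_, ?_⟩
  · have h1 : D.SameCoset (H ⊓ H') (ν.symm ∘ σ ∘ Z 0 ∘ ry) (ν.symm ∘ Z 1 ∘ ry) :=
      SameCoset.comp (hH.inf hH') (fixingAut_symm hν) (D.comp_mem_dom _ (hmul 0).1.2.2)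
        (hmul 1).1.2.2 ⟨hσH, hσ1⟩
    rw [← hν1, ← hρ1] at h1
    have e : ν.symm ∘ ν ∘ y 1 ∘ r = y 1 ∘ r := congrArg (· ∘ r) (hνs (y 1))
    rw [e] at h1
    exact h1
  · have e : (ν.symm.comp (σ.comp ρ)) ∘ y 1 = ν.symm ∘ σ ∘ ρ ∘ y 1 := rfl
    have e' : σ ∘ Z 1 ∘ Sum.inr = Z 0 ∘ Sum.inr := congrArg (· ∘ Sum.inr) hσ2
    rw [e, hρ2, e', ← hν2, hνs]

end DefinableGroup

end DefinableGroup

/-! ### The Baldwin–Saxl argument under NIP -/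

section NIP

variable {L : Language.{u, v}} {M : Type w} [L.Structure M] {κ : Cardinal.{w}}

/-- Saturation for a family of formulas. -/
theorem IsSaturated.exists_realize_family [Nonempty M] (sat : IsSaturated L M κ) (hκ : ℵ₀ ≤ κ)
    {E γ : Type w} (hE : #E < κ) (hγ : #γ < κ) (e : E → M) {I : Type*}
    (F : I → L.Formula (E ⊕ γ))
    (h : ∀ s : Finset I, ∃ x : γ → M, ∀ i ∈ s, (F i).Realize (Sum.elim e x)) :
    ∃ x : γ → M, ∀ i, (F i).Realize (Sum.elim e x) := by
  classical
  obtain ⟨x, hx⟩ := sat.exists_realize hκ hE hγ e (Set.range F) fun q hq => by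
    choose j hj using fun φ : q => hq φ.2
    obtain ⟨x, hx⟩ := h (q.attach.image j)
    refine ⟨x, fun φ hφ => ?_⟩
    have := hx _ (Finset.mem_image_of_mem j (Finset.mem_attach q ⟨φ, hφ⟩))
    rwa [hj] at this
  exact ⟨x, fun i => hx _ ⟨i, rfl⟩⟩

theorem Formula.exists_restrict_right {n : ℕ} {ι : Type*} (θ : L.Formula (Fin n ⊕ ι)) :
    ∃ (m : ℕ) (c : Fin m → ι) (θ' : L.Formula (Fin m ⊕ Fin n)), ∀ (x : Fin n → M) (a : ι → M),
      θ'.Realize (Sum.elim (a ∘ c) x) ↔ θ.Realize (Sum.elim x a) := by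
  classical
  let S : Finset ι := θ.freeVarFinset.preimage Sum.inr Sum.inr_injective.injOn
  let f : θ.freeVarFinset → Fin S.card ⊕ Fin n := fun c =>
    match c with
    | ⟨Sum.inl i, _⟩ => Sum.inr i
    | ⟨Sum.inr j, h⟩ => Sum.inl (S.equivFin ⟨j, Finset.mem_preimage.2 h⟩)
  refine ⟨S.card, fun k => S.equivFin.symm k, θ.restrictFreeVar f, fun x a =>
    Formula.realize_restrictFreeVar_iff _ ?_⟩
  rintro ⟨i | j, h⟩
  · rfl
  · simp [f]

theorem _root_.Subgroup.exists_list_prod_eq {G : Type*} [Group G] {I : Type*} (K : Subgroup G)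
    {l : List I} (hl : l.Nodup) {j : I} (hj : j ∈ l) (f : I → G)
    (hf : ∀ i, i ≠ j → f i ∈ K) : ∃ A ∈ K, ∃ B ∈ K, (l.map f).prod = A * f j * B := by
  obtain ⟨s, t, rfl⟩ := List.append_of_mem hj
  have hd := (List.nodup_middle.1 hl)
  rw [List.nodup_cons, List.mem_append, not_or] at hd
  refine ⟨(s.map f).prod, K.list_prod_mem ?_, (t.map f).prod, K.list_prod_mem ?_, ?_⟩
  · intro x hx
    obtain ⟨i, hi, rfl⟩ := List.mem_map.1 hx
    exact hf i fun e => hd.1.1 (e ▸ hi)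
  · intro x hx
    obtain ⟨i, hi, rfl⟩ := List.mem_map.1 hx
    exact hf i fun e => hd.1.2 (e ▸ hi)
  · simp [mul_assoc]

namespace DefinableGroup

variable {G : Type z} [Group G] {D : DefinableGroup L M G} {ι : Type w} {H : Subgroup G}
  {p : Set (L.Formula (Fin D.n ⊕ ι))} {a : ι → M}

/-- For `ψ ∈ p` there is a finite conjunction `θ` of formulas in `p` with `H · θ · H ⊆ ψ`. -/
theorem IsTypeDefinedBy.exists_mul_mul_subset [Nonempty M] (hp : D.IsTypeDefinedBy H p a)
    (sat : IsSaturated L M κ) (hκ : ℵ₀ < κ) (hι : #ι < κ) {ψ : L.Formula (Fin D.n ⊕ ι)}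
    (hψ : ψ ∈ p) :
    ∃ θ : L.Formula (Fin D.n ⊕ ι), (∀ (b : ι → M), ∀ x ∈ solutionSet p b,
        θ.Realize (Sum.elim x b)) ∧
      ∀ y ∈ D.dom, θ.Realize (Sum.elim y a) → ∀ g ∈ H, ∀ h ∈ H, ∀ x ∈ D.dom,
        D.proj x = g * D.proj y * h → ψ.Realize (Sum.elim x a) := by
  classical
  by_contra! hcon
  obtain ⟨μ, hμ⟩ := D.exists_formula_mul
  -- The slots hold representatives of g, h, y, the product gy, and x = gyh.
  let γ := ULift.{w} (Fin 5) × Fin D.n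
  let ty : Fin 5 → L.Formula (Fin D.n ⊕ ι) → L.Formula (ι ⊕ γ) := fun k φ =>
    φ.relabel (Sum.elim (fun i => Sum.inr (⟨k⟩, i)) Sum.inl)
  have hty : ∀ k φ (x : γ → M),
      (ty k φ).Realize (Sum.elim a x) ↔ φ.Realize (Sum.elim (fun i => x (⟨k⟩, i)) a) := by
    intro k φ x
    rw [Formula.realize_relabel]
    have : Sum.elim a x ∘ (Sum.elim (fun i => Sum.inr (⟨k⟩, i)) Sum.inl) =
        Sum.elim (fun i => x (⟨k⟩, i)) a := by
      ext (i | i) <;> rfl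
    rw [this]
  let mu : Fin 5 → Fin 5 → Fin 5 → L.Formula (ι ⊕ γ) := fun k l m =>
    μ.relabel (fun c => Sum.inr (⟨![k, l, m] c.1⟩, c.2))
  have hmu : ∀ k l m (x : γ → M), (mu k l m).Realize (Sum.elim a x) ↔
      μ.Realize (fun c => ![fun i => x (⟨k⟩, i), fun i => x (⟨l⟩, i), fun i => x (⟨m⟩, i)]
        c.1 c.2) := by
    intro k l m x
    rw [Formula.realize_relabel]
    have : (Sum.elim a x ∘ fun c : Fin 3 × Fin D.n => Sum.inr (⟨![k, l, m] c.1⟩, c.2)) =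
        fun c => ![fun i => x (⟨k⟩, i), fun i => x (⟨l⟩, i), fun i => x (⟨m⟩, i)] c.1 c.2 := by
      ext ⟨c, i⟩
      fin_cases c <;> rfl
    rw [this]
  obtain ⟨x, hx⟩ := sat.exists_realize_family hκ.le hι (γ := γ) (mk_lt_aleph0.trans hκ) a
    (I := (Fin 3 × p) ⊕ Fin 3)
    (Sum.elim (fun c => ty (Fin.castLE (by norm_num) c.1) c.2)
      ![mu 0 2 3, mu 3 1 4, ∼(ty 4 ψ)]) fun s => by
    let q : Finset p := s.toLeft.image Prod.snd
    obtain ⟨y, hy, hyθ, g, hg, h, hh, t, ht, htgh, hψt⟩ := hcon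
      (Formula.iInf fun φ : q => φ.1.1) fun b x hx => by
        rw [Formula.realize_iInf]
        exact fun φ => hx _ φ.1.2
    rw [Formula.realize_iInf] at hyθ
    obtain ⟨xg, hxg, rfl⟩ := D.surj g
    obtain ⟨xh, hxh, rfl⟩ := D.surj h
    obtain ⟨xm, hxm, hxm'⟩ := D.surj (D.proj xg * D.proj y)
    refine ⟨fun c => ![xg, xh, y, xm, t] c.1.down c.2, ?_⟩
    rintro (⟨k, φ⟩ | k) hi
    · rw [Sum.elim_inl, hty]
      fin_cases k
      · exact hp.mem_solutionSet hxg hg _ φ.2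
      · exact hp.mem_solutionSet hxh hh _ φ.2
      · exact hyθ ⟨φ, Finset.mem_image.2 ⟨_, Finset.mem_toLeft.2 hi, rfl⟩⟩
    · rw [Sum.elim_inr]
      fin_cases k
      · exact (hmu _ _ _ _).2 ((hμ xg y xm).2 ⟨⟨hxg, hy, hxm⟩, hxm'.symm⟩)
      · refine (hmu _ _ _ _).2 ((hμ xm xh t).2 ⟨⟨hxm, hxh, ht⟩, ?_⟩)
        rw [hxm', htgh]
      · exact Formula.realize_not.2 fun h => hψt ((hty _ _ _).1 h)
  have hs : ∀ k : Fin 3, (fun i => x (⟨Fin.castLE (by norm_num) k⟩, i)) ∈ solutionSet p a :=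
    fun k φ hφ => (hty _ _ _).1 (hx (Sum.inl (k, ⟨φ, hφ⟩)))
  have h1 := (hμ _ _ _).1 ((hmu _ _ _ _).1 (hx (Sum.inr 0)))
  have h2 := (hμ _ _ _).1 ((hmu _ _ _ _).1 (hx (Sum.inr 1)))
  have h3 : ¬ (ty 4 ψ).Realize (Sum.elim a x) := Formula.realize_not.1 (hx (Sum.inr 2))
  refine h3 ((hty _ _ _).2 (hp.mem_solutionSet h2.1.2.2 ?_ ψ hψ))
  rw [← h2.2, ← h1.2]
  exact H.mul_mem (H.mul_mem (hp.proj_mem (hs 0)) (hp.proj_mem (hs 2))) (hp.proj_mem (hs 1))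

/-- In a structure with NIP there are no arbitrarily long finite families of conjugates of `H`
with elements `fₖ` that belong to all members of the family except the `k`-th one, from which they
are uniformly separated by `ψ`. -/
theorem IsTypeDefinedBy.false_of_isNIP [Nonempty M] {T : L.Theory} (hT : Theory.IsNIP.{u, v, w} T) [M ⊨ T]
    (hp : D.IsTypeDefinedBy H p a) (sat : IsSaturated L M κ) (hκ : ℵ₀ < κ) (hι : #ι < κ)
    {ψ : L.Formula (Fin D.n ⊕ ι)} (hψ : ψ ∈ p)
    (h : ∀ n : ℕ, ∃ (σ : Fin n → (M ≃[L] M)) (f : Fin n → G),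
      (∀ i k, i ≠ k → f k ∈ H.map (D.act (σ i))) ∧
      ∀ k, ∃ u ∈ H.map (D.act (σ k)), ∃ v ∈ H.map (D.act (σ k)), ∃ x ∈ D.dom,
        D.proj x = u * f k * v ∧ ¬ ψ.Realize (Sum.elim x (σ k ∘ a))) : False := by
  classical
  obtain ⟨θ, hθ1, hθ2⟩ := hp.exists_mul_mul_subset sat hκ hι hψ
  have hθ3 : ∀ (σ : M ≃[L] M), ∀ y ∈ D.dom, θ.Realize (Sum.elim y (σ ∘ a)) →
      ∀ g ∈ H.map (D.act σ), ∀ h ∈ H.map (D.act σ), ∀ x ∈ D.dom,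
        D.proj x = g * D.proj y * h → ψ.Realize (Sum.elim x (σ ∘ a)) := by
    intro σ y hy hyθ g hg h hh x hx e
    have hs : ∀ t : Fin D.n → M, σ ∘ σ.symm ∘ t = t := fun t =>
      funext fun i => Equiv.apply_symm_apply σ (t i)
    have hreal : ∀ (φ : L.Formula (Fin D.n ⊕ ι)) (t : Fin D.n → M),
        φ.Realize (Sum.elim t (σ ∘ a)) ↔ φ.Realize (Sum.elim (σ.symm ∘ t) a) := by
      intro φ t
      conv_lhs => rw [← hs t, ← Sum.comp_elim, StrongHomClass.realize_formula]
    rw [hreal] at hyθ ⊢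
    refine hθ2 _ (D.comp_mem_dom _ hy) hyθ _ (mem_map_act D |>.1 hg) _ (mem_map_act D |>.1 hh) _
      (D.comp_mem_dom _ hx) ?_
    rw [← D.act_proj _ hx, ← D.act_proj _ hy, e, map_mul, map_mul]
  obtain ⟨m, c, θ', hθ'⟩ := Formula.exists_restrict_right (M := M) θ
  -- The negation is shattered: the product over `s` lies in the `i`-th conjugate, hence satisfies
  -- `θ`, if `i ∉ s`, and fails `θ` if `i ∈ s`.
  obtain ⟨n, hn⟩ := hT m D.n (∼θ')
  obtain ⟨σ, f, hf1, hf2⟩ := h n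
  choose b hb hbw using fun s : Set (Fin n) =>
    D.surj (((List.finRange n).map fun i => if i ∈ s then f i else 1).prod)
  refine hn M ⟨fun i => (σ i ∘ a) ∘ c, b, fun i s => ?_⟩
  rw [Formula.realize_not, hθ', not_iff_comm]
  constructor
  · intro hi
    refine hθ1 _ _ ((hp.map_act (σ i)).mem_solutionSet (hb s) ?_)
    rw [hbw]
    refine Subgroup.list_prod_mem _ fun g hg => ?_
    obtain ⟨k, -, rfl⟩ := List.mem_map.1 hg
    split_ifs with hk
    · exact hf1 i k fun e => hi (e ▸ hk)
    · exact one_mem _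
  · intro hθb hi
    obtain ⟨A, hA, B, hB, e⟩ := Subgroup.exists_list_prod_eq (H.map (D.act (σ i)))
      (List.nodup_finRange n) (List.mem_finRange i) (fun i => if i ∈ s then f i else 1)
      fun k hk => by
        split_ifs
        · exact hf1 i k hk.symm
        · exact one_mem _
    obtain ⟨u, hu, v, hv, x, hx, hxe, hxψ⟩ := hf2 i
    refine hxψ (hθ3 (σ i) (b s) (hb s) hθb (u * A⁻¹) (mul_mem hu (inv_mem hA)) (B⁻¹ * v)
      (mul_mem (inv_mem hB) hv) x hx ?_)
    rw [hbw, e, if_pos hi, hxe]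
    group

end DefinableGroup

end NIP

/-! ### Excluding infinite chains by stability and NIP -/

section Chains

variable {L : Language.{u, v}} {M : Type w} [L.Structure M] {κ : Cardinal.{w}}

namespace DefinableGroup

variable {G : Type z} [Group G] {D : DefinableGroup L M G} {ι : Type w} {H : Subgroup G}
  {p : Set (L.Formula (Fin D.n ⊕ ι))} {a : ι → M}

/-- Finite intersections of conjugates of `H` have a stable quotient. -/
theorem isSeqStable_biInf [Nonempty M] (hp : D.IsTypeDefinedBy H p a)
    (hst : D.IsStableQuotient κ H (Set.range a)) (sat : IsSaturated L M κ)
    (hom : IsStronglyHomogeneous L M κ) (hκ : ℵ₀ < κ) (hι : #ι < κ) (ρ : ℕ → (M ≃[L] M))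
    (T : Finset ℕ) :
    D.IsInvariantOver (⨅ k ∈ T, H.map (D.act (ρ k)))
        (Set.range fun c : T × ι => ρ c.1 (a c.2)) ∧
      D.IsSeqStable κ (⨅ k ∈ T, H.map (D.act (ρ k)))
        (Set.range fun c : T × ι => ρ c.1 (a c.2)) := by
  classical
  induction T using Finset.induction_on with
  | empty =>
    simp only [Finset.notMem_empty, iInf_false, iInf_top]
    exact ⟨fun _ _ _ _ => Subgroup.mem_top _, isSeqStable_top⟩
  | insert k T hk ih =>
    have hT : Set.range (fun c : T × ι => ρ c.1 (a c.2)) ⊆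
        Set.range fun c : ↥(insert k T : Finset ℕ) × ι => ρ c.1 (a c.2) := by
      rintro _ ⟨c, rfl⟩
      exact ⟨(⟨c.1, Finset.mem_insert_of_mem c.1.2⟩, c.2), rfl⟩
    have hk : Set.range (ρ k ∘ a) ⊆
        Set.range fun c : ↥(insert k T : Finset ℕ) × ι => ρ c.1 (a c.2) := by
      rintro _ ⟨j, rfl⟩
      exact ⟨(⟨k, Finset.mem_insert_self _ _⟩, j), rfl⟩
    have hcard : #(Set.range fun c : ↥(insert k T : Finset ℕ) × ι => ρ c.1 (a c.2)) < κ :=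
      mk_range_prod_lt hκ hι _
    have hpk := hp.map_act (ρ k)
    have hstk := (hst.isSeqStable (hp.isInvariantOver subset_rfl)).map_act (ρ k)
    rw [← Set.range_comp] at hstk
    rw [Finset.iInf_insert]
    exact ⟨(hpk.isInvariantOver hk).inf (ih.1.mono hT),
      (hstk.mono hκ.le hk hcard).inf hpk hk (ih.2.mono hκ.le hT hcard) (ih.1.mono hT)
        sat hom hκ hcard⟩

theorem IsTypeDefinedBy.false_of_chain [Nonempty M] {T : L.Theory}
    (hT : Theory.IsNIP.{u, v, w} T) [M ⊨ T] (hp : D.IsTypeDefinedBy H p a)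
    (hst : D.IsStableQuotient κ H (Set.range a)) (sat : IsSaturated L M κ)
    (hom : IsStronglyHomogeneous L M κ) (hκ : ℵ₀ < κ) (hι : #ι < κ)
    {ψ : L.Formula (Fin D.n ⊕ ι)} (hψ : ψ ∈ p) (σ : ℕ → (M ≃[L] M)) (x : ℕ → Fin D.n → M)
    (hx : ∀ m n, m < n → x n ∈ solutionSet p (σ m ∘ a))
    (hxψ : ∀ n, ¬ ψ.Realize (Sum.elim (x n) (σ n ∘ a))) : False := by
  classical
  have hβ : #(ι ⊕ Fin D.n) < κ := by
    rw [Cardinal.mk_sum, Cardinal.mk_fin, Cardinal.lift_natCast]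
    exact Cardinal.add_lt_of_lt hκ.le (by simpa using hι) (Cardinal.natCast_lt_aleph0.trans hκ)
  have h0 : #(∅ : Set M) < κ := by
    rw [Cardinal.mk_eq_zero]
    exact Cardinal.aleph0_pos.trans hκ
  let Y : ℕ → ι ⊕ Fin D.n → M := fun n => Sum.elim (σ n ∘ a) (x n)
  obtain ⟨Z, hZ, hEM⟩ := exists_isIndiscernible sat hom hκ h0 hβ Y
  have hρ : ∀ q, ∃ ρ : M ≃[L] M, ρ ∘ a = Z q ∘ Sum.inl := by
    intro q
    obtain ⟨ρ, -, e⟩ := exists_fixingAut_of_forall_formula (y := Y) (y' := Z) hom hκ h0 hι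
      (hEM 1) subset_rfl (fun j => (0, Sum.inl j)) a
      (fun t _ => ⟨σ (t 0), by simp [fixingAut], fun j => rfl⟩) (fun _ => q)
      (Subsingleton.strictMono _)
    exact ⟨ρ, funext e⟩
  choose ρ hρ using hρ
  have hK : ∀ q, D.IsTypeDefinedBy (H.map (D.act (ρ q))) p (Z q ∘ Sum.inl) := fun q =>
    hρ q ▸ hp.map_act (ρ q)
  have transfer : ∀ (φ : L.Formula (Fin D.n ⊕ ι)) {m : ℕ} (i j : Fin m),
      (∀ t : Fin m → ℕ, StrictMono t → φ.Realize (Sum.elim (x (t i)) (σ (t j) ∘ a))) →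
      ∀ s : Fin m → ℚ, StrictMono s →
        φ.Realize (Sum.elim (Z (s i) ∘ Sum.inr) (Z (s j) ∘ Sum.inl)) := by
    intro φ m i j h s hs
    have hrel : ∀ f : Fin m × (ι ⊕ Fin D.n) → M,
        (φ.relabel (Sum.elim (fun k => Sum.inr (i, Sum.inr k)) fun k => Sum.inr (j, Sum.inl k)) :
          L.Formula ((∅ : Set M) ⊕ (Fin m × (ι ⊕ Fin D.n)))).Realize (Sum.elim (↑) f) ↔
        φ.Realize (Sum.elim (fun k => f (i, Sum.inr k)) fun k => f (j, Sum.inl k)) := by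
      intro f
      rw [Formula.realize_relabel, Sum.comp_elim]
      rfl
    exact (hrel _).1 (hEM m _ (fun t ht => (hrel _).2 (h t ht)) s hs)
  have hZp : ∀ q q', q < q' → Z q' ∘ Sum.inr ∈ solutionSet p (Z q ∘ Sum.inl) := by
    intro q q' hq φ hφ
    refine transfer φ (1 : Fin 2) 0 (fun t ht => hx _ _ (ht (by decide)) φ hφ) ![q, q'] ?_
    rw [Fin.strictMono_iff_lt_succ]
    intro i
    fin_cases i
    exact hq
  have hZψ : ∀ q, ¬ ψ.Realize (Sum.elim (Z q ∘ Sum.inr) (Z q ∘ Sum.inl)) := fun q =>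
    Formula.realize_not.1 (transfer (∼ψ) (0 : Fin 1) 0 (fun t _ => Formula.realize_not.2 (hxψ _))
      (fun _ => q) (Subsingleton.strictMono _))
  have hdom : ∀ q, Z q ∘ Sum.inr ∈ D.dom := fun q => (hK (q - 1)).mem_dom (hZp _ _ (by simp))
  have hcK : ∀ q q', q < q' → D.proj (Z q' ∘ Sum.inr) ∈ H.map (D.act (ρ q)) := fun q q' h =>
    (hK q).proj_mem (hZp q q' h)
  have hconj : ∀ q q' : ℚ, q < q' →
      ∃ τ : M ≃[L] M, τ ∘ Z 0 = Z q ∧ τ ∘ Z 1 = Z q' := by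
    intro q q' h
    obtain ⟨τ, -, e⟩ := hZ 2 ![0, 1] ![q, q'] (by
      rw [Fin.strictMono_iff_lt_succ]
      intro i
      fin_cases i
      exact zero_lt_one) (by
      rw [Fin.strictMono_iff_lt_succ]
      intro i
      fin_cases i
      exact h)
    exact ⟨τ, e 0, e 1⟩
  -- If earlier elements also lie in later conjugates, each element lies in all conjugates but its
  -- own, and NIP applies directly.
  by_cases hc : Z 0 ∘ Sum.inr ∈ solutionSet p (Z 1 ∘ Sum.inl)
  · have hc' : ∀ q q', q < q' → D.proj (Z q ∘ Sum.inr) ∈ H.map (D.act (ρ q')) := by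
      intro q q' h
      obtain ⟨τ, h1, h2⟩ := hconj q q' h
      refine (hK q').proj_mem ?_
      rw [← h1, ← h2]
      exact comp_mem_solutionSet τ |>.2 hc
    refine hp.false_of_isNIP hT sat hκ hι hψ fun n => ⟨fun i => ρ (i : ℕ),
      fun i => D.proj (Z (i : ℕ) ∘ Sum.inr), fun i k hik => ?_, fun k =>
        ⟨1, one_mem _, 1, one_mem _, _, hdom (k : ℕ), by simp, ?_⟩⟩
    · rcases hik.lt_or_gt with h | h
      · exact hcK _ _ (by exact_mod_cast h)
      · exact hc' _ _ (by exact_mod_cast h)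
    · rw [hρ]
      exact hZψ _
  · simp only [solutionSet, Set.mem_ofPred_eq, not_forall] at hc
    obtain ⟨χ, hχ, hcχ⟩ := hc
    have hcχ' : ∀ q : ℚ, 0 < q → ¬ χ.Realize (Sum.elim (Z 0 ∘ Sum.inr) (Z q ∘ Sum.inl)) := by
      intro q hq
      obtain ⟨τ, h1, h2⟩ := hconj 0 q hq
      rw [← h2]
      conv in Sum.elim _ _ => rw [← h1]
      rw [Function.comp_assoc, Function.comp_assoc, ← Sum.comp_elim,
        StrongHomClass.realize_formula]
      exact hcχ
    -- Stability factors c_0 across the cut between m and m+1. For m ≥ n the second condition is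
    -- vacuous.
    have split : ∀ n m : ℕ, ∃ g E : G, g * E = D.proj (Z 0 ∘ Sum.inr) ∧
        (∀ i : ℕ, 1 ≤ i → i ≤ m → g ∈ H.map (D.act (ρ i))) ∧
        ∀ i : ℕ, m < i → i ≤ n → E ∈ H.map (D.act (ρ i)) := by
      intro n m
      let F := Finset.Ioc m n
      obtain ⟨hinv, hsta⟩ := isSeqStable_biInf hp hst sat hom hκ hι (fun k => ρ k) F
      set K : Subgroup G := ⨅ k ∈ F, H.map (D.act (ρ k))
      set B : Set M := Set.range fun c : F × ι => ρ c.1 (a c.2)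
      have hB : #B < κ := mk_range_prod_lt hκ hι _
      -- The parameters of `K` sit at positions at least m+1, so the part of the sequence below m+1
      -- is indiscernible over them.
      have hind : IsIndiscernible L B (fun q : Set.Iio (m + 1 : ℚ) => Z q) := by
        intro d s t hs ht
        have hF : ∀ k : F, (m + 1 : ℚ) ≤ (k : ℕ) := fun k => by
          exact_mod_cast (Finset.mem_Ioc.1 k.2).1
        obtain ⟨τ, -, e⟩ := hZ.exists_fixingAut hom hκ h0 hβ (J := Fin d ⊕ F)
          (Sum.elim (fun k => (s k : ℚ)) (fun k => ((k : ℕ) : ℚ)))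
          (Sum.elim (fun k => (t k : ℚ)) (fun k => ((k : ℕ) : ℚ))) (by
            rintro (i | i) (j | j)
            · exact hs.lt_iff_lt.trans ht.lt_iff_lt.symm
            · exact iff_of_true ((s i).2.trans_le (hF j)) ((t i).2.trans_le (hF j))
            · exact iff_of_false ((s j).2.trans_le (hF i)).not_gt ((t j).2.trans_le (hF i)).not_gt
            · exact Iff.rfl)
        refine ⟨τ, ?_, fun k => e (Sum.inl k)⟩
        rintro _ ⟨c, rfl⟩
        have h1 := congrFun (e (Sum.inr c.1)) (Sum.inl c.2)
        have h2 := congrFun (hρ ((c.1 : ℕ) : ℚ)) c.2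
        simp only [Function.comp_apply, Sum.elim_inr] at h1 h2
        simp only [h2, h1]
      -- The target m+1/2 lies above 1, …, m, so its element belongs to those conjugates, and below
      -- m+1, so it stays in the indiscernible part.
      obtain ⟨τ, hτ, hτ1, hτ2⟩ := hsta.exists_shift hinv hom hκ hB hβ (r := Sum.inr)
        (fun q : Set.Iio (m + 1 : ℚ) => hdom q) hind
        (s := ⟨0, by simp only [Set.mem_Iio]; positivity⟩)
        (s' := ⟨m + 1 / 2, by simp only [Set.mem_Iio]; norm_num⟩)
        (Subtype.mk_lt_mk.2 (by positivity)) (F := {q | ∃ i : ℕ, 1 ≤ i ∧ i ≤ m ∧ (q : ℚ) = i})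
        (P := ∅) (by
          rintro ⟨q, hq⟩ ⟨i, hi, him, rfl⟩
          refine ⟨Subtype.mk_lt_mk.2 (by exact_mod_cast hi), Subtype.mk_lt_mk.2 ?_⟩
          have : (i : ℚ) ≤ m := by exact_mod_cast him
          linarith) (by simp)
      have hτs := fixingAut_symm hτ
      set c' : Fin D.n → M := Z (m + 1 / 2) ∘ Sum.inr
      have hE := hinv _ hτs _ hτ1.symm
      rw [map_mul, map_inv, D.act_proj _ (D.comp_mem_dom _ (hdom 0))] at hE
      have e0 : τ.symm ∘ τ ∘ Z 0 ∘ Sum.inr = Z 0 ∘ Sum.inr :=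
        funext fun i => Equiv.symm_apply_apply τ _
      refine ⟨D.act τ.symm (D.proj c'), (D.act τ.symm (D.proj c'))⁻¹ * D.proj (Z 0 ∘ Sum.inr),
        mul_inv_cancel_left _ _, fun i hi him => ?_, fun i hi hin => ?_⟩
      · have him' : (i : ℚ) ≤ m := by exact_mod_cast him
        refine (hK i).act_mem (hK i) (σ := τ.symm) ?_ (hcK i (m + 1 / 2) (by linarith))
        have h1 := hτ2 ⟨i, by simp only [Set.mem_Iio]; linarith⟩ (Or.inl ⟨i, hi, him, rfl⟩)
        ext j
        have h2 := congrFun h1 (Sum.inl j)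
        simp only [Function.comp_apply] at h2 ⊢
        conv_lhs => rw [← h2]
        exact Equiv.symm_apply_apply τ _
      · have h1 : K ≤ H.map (D.act (ρ i)) := iInf₂_le i (Finset.mem_Ioc.2 ⟨hi, hin⟩)
        refine h1 ?_
        rw [e0] at hE
        exact hE
    refine hp.false_of_isNIP hT sat hκ hι hχ fun n => ?_
    choose g E hgE hg hE using split n
    -- Consecutive factorizations differ only in the side of the cut on which k+1 lies; their
    -- quotient therefore singles out that conjugate.
    refine ⟨fun i => ρ ((i + 1 : ℕ) : ℚ), fun k => (g (k + 1))⁻¹ * g k, fun i k hik => ?_,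
      fun k => ⟨g (k + 1), hg _ _ (by simp) le_rfl, E k, hE _ _ (Nat.lt_succ_self _) k.2,
        _, hdom 0, ?_, ?_⟩⟩
    · rcases hik.lt_or_gt with h | h
      · exact mul_mem (inv_mem (hg _ _ (by simp) (by have : (i : ℕ) < k := h; omega)))
          (hg _ _ (by simp) h)
      · have h1 : (g (k + 1))⁻¹ * g k = E (k + 1) * (E k)⁻¹ := by
          rw [eq_mul_inv_iff_mul_eq, mul_assoc, hgE, ← hgE (k + 1), inv_mul_cancel_left]
        change (g (k + 1))⁻¹ * g k ∈ _
        rw [h1]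
        have h' : (k : ℕ) < i := h
        exact mul_mem (hE _ _ (by omega) i.2) (inv_mem (hE _ _ (by omega) i.2))
    · rw [mul_inv_cancel_left, hgE]
    · rw [hρ]
      exact hcχ' _ (by positivity)

end DefinableGroup

end Chains

/-! ### From chains to a bounded subintersection -/

section BoundedSubintersection

variable {L : Language.{u, v}} {M : Type w} [L.Structure M] {κ : Cardinal.{w}}

/-- For every formula `ψ` of the type that defines `H`, finitely many conjugates of `H` over `A`
have an intersection contained in all the conjugates of `ψ` over `A`. -/
theorem DefinableGroup.IsTypeDefinedBy.exists_finset [Nonempty M] {G : Type z} [Group G]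
    {D : DefinableGroup L M G} {ι : Type w} {H : Subgroup G}
    {p : Set (L.Formula (Fin D.n ⊕ ι))} {a : ι → M} {T : L.Theory}
    (hT : Theory.IsNIP.{u, v, w} T) [M ⊨ T] (hp : D.IsTypeDefinedBy H p a)
    (hst : D.IsStableQuotient κ H (Set.range a)) (sat : IsSaturated L M κ)
    (hom : IsStronglyHomogeneous L M κ) (hκ : ℵ₀ < κ) (hι : #ι < κ) (A : Set M)
    {ψ : L.Formula (Fin D.n ⊕ ι)} (hψ : ψ ∈ p) :
    ∃ F : Finset (M ≃[L] M), (F : Set (M ≃[L] M)) ⊆ fixingAut L A ∧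
      ∀ σ ∈ fixingAut L A, ∀ x : Fin D.n → M, (∀ τ ∈ F, x ∈ solutionSet p (τ ∘ a)) →
        ψ.Realize (Sum.elim x (σ ∘ a)) := by
  classical
  by_contra! hcon
  -- If no finite family works, each finite stage yields a new conjugate with a point of all earlier
  -- ones violating `ψ`: a forbidden chain.
  obtain ⟨f, hf1, hf2⟩ := exists_seq_of_forall_finset_exists
    (fun c : (M ≃[L] M) × (Fin D.n → M) =>
      c.1 ∈ fixingAut L A ∧ ¬ ψ.Realize (Sum.elim c.2 (c.1 ∘ a)))
    (fun c d => d.2 ∈ solutionSet p (c.1 ∘ a)) (fun s hs => by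
      obtain ⟨σ, hσ, x, hx, hψx⟩ := hcon (s.image Prod.fst) (by
        intro τ hτ
        obtain ⟨c, hc, rfl⟩ := Finset.mem_image.1 hτ
        exact (hs c hc).1)
      exact ⟨(σ, x), ⟨hσ, hψx⟩, fun c hc => hx _ (Finset.mem_image_of_mem _ hc)⟩)
  exact hp.false_of_chain hT hst sat hom hκ hι hψ (fun n => (f n).1) (fun n => (f n).2) hf2
    fun n => (hf1 n).2

/-- An inclusion of a finite intersection of conjugates of a partial type in all conjugates of a
formula passes to elementary extensions. -/
theorem realize_of_mem_typeRealizations [Nonempty M] (sat : IsSaturated L M κ)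
    (hom : IsStronglyHomogeneous L M κ) (hκ : ℵ₀ < κ) {n : ℕ} {ι : Type w} (hι : #ι < κ)
    {p : Set (L.Formula (Fin n ⊕ ι))} {a : ι → M} {A : Set M} (hA : #A < κ)
    {F : Finset (M ≃[L] M)} {ψ : L.Formula (Fin n ⊕ ι)}
    (h : ∀ σ ∈ fixingAut L A, ∀ x : Fin n → M, (∀ τ ∈ F, x ∈ solutionSet p (τ ∘ a)) →
        ψ.Realize (Sum.elim x (σ ∘ a)))
    {N : Type w} [L.Structure N] (f : M ↪ₑ[L] N) {a' : ι → N}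
    (ha' : a' ∈ typeRealizations f A a) {x : Fin n → N}
    (hx : ∀ τ ∈ F, x ∈ solutionSet p fun i => f (τ (a i))) : ψ.Realize (Sum.elim x a') := by
  classical
  by_contra hψ
  have : Nonempty N := ‹Nonempty M›.map f
  have hE : #(A ⊕ (F × ι)) < κ := by
    rw [Cardinal.mk_sum, Cardinal.lift_id, Cardinal.lift_id, Cardinal.mk_prod, Cardinal.lift_id,
      Cardinal.lift_id]
    exact Cardinal.add_lt_of_lt hκ.le hA (Cardinal.mul_lt_of_lt hκ.le (mk_lt_aleph0.trans hκ) hι)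
  have hγ : #(ι ⊕ Fin n) < κ := by
    rw [Cardinal.mk_sum, Cardinal.mk_fin, Cardinal.lift_natCast]
    exact Cardinal.add_lt_of_lt hκ.le (by simpa using hι) (Cardinal.natCast_lt_aleph0.trans hκ)
  let e : A ⊕ (F × ι) → M := Sum.elim (↑) fun c => c.1.1 (a c.2)
  let tp : Set (L.Formula (A ⊕ ι)) := {χ | χ.Realize (Sum.elim (↑) a)}
  -- `Φ` describes a counterexample. It holds in `N`, so it is finitely satisfiable in `M` by
  -- elementarity and realized there by saturation; homogeneity makes the realization of tp(a/A) a
  -- conjugate of `a`, contradicting `h`.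
  let Φ : (F × p) ⊕ (tp ⊕ Unit) → L.Formula ((A ⊕ (F × ι)) ⊕ (ι ⊕ Fin n)) :=
    Sum.elim
      (fun c => c.2.1.relabel
        (Sum.elim (fun i => Sum.inr (Sum.inr i)) fun j => Sum.inl (Sum.inr (c.1, j))))
      (Sum.elim
        (fun χ => χ.1.relabel (Sum.elim (fun b => Sum.inl (Sum.inl b)) fun j => Sum.inr (Sum.inl j)))
        fun _ => Formula.relabel
          (Sum.elim (fun i => Sum.inr (Sum.inr i)) fun j => Sum.inr (Sum.inl j)) (∼ψ))
  have hN : ∀ c, (Φ c).Realize (Sum.elim (f ∘ e) (Sum.elim a' x)) := by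
    rintro (⟨τ, φ⟩ | χ | u)
    · refine Formula.realize_relabel.2 ?_
      rw [Sum.comp_elim]
      exact hx τ τ.2 φ φ.2
    · refine Formula.realize_relabel.2 ?_
      rw [Sum.comp_elim]
      exact (ha' χ.1).1 χ.2
    · refine Formula.realize_relabel.2 (Formula.realize_not.2 ?_)
      rw [Sum.comp_elim]
      exact hψ
  obtain ⟨y, hy⟩ := sat.exists_realize_family hκ.le hE hγ e Φ fun s => by
    obtain ⟨θ, hθ⟩ := Formula.exists_realize_iff.{u, v, w} (Formula.iInf fun c : s => Φ c)
    have h1 : θ.Realize e := by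
      rw [← f.map_formula, hθ]
      exact ⟨Sum.elim a' x, Formula.realize_iInf.2 fun c => hN c⟩
    obtain ⟨y, hy⟩ := (hθ M e).1 h1
    exact ⟨y, fun c hc => Formula.realize_iInf.1 hy ⟨c, hc⟩⟩
  have htp : ∀ χ : L.Formula (A ⊕ ι), χ.Realize (Sum.elim (↑) a) →
      χ.Realize (Sum.elim (↑) (y ∘ Sum.inl)) := by
    intro χ hχ
    have h1 := Formula.realize_relabel.1 (hy (Sum.inr (Sum.inl ⟨χ, hχ⟩)))
    rw [Sum.comp_elim] at h1
    exact h1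
  obtain ⟨σ, hσ, hσa⟩ := hom.exists_fixingAut hκ.le hA (x := a) (y := y ∘ Sum.inl)
    (Cardinal.mk_range_le.trans_lt hι) fun χ => ⟨htp χ, fun h1 => by
      by_contra hn
      exact Formula.realize_not.1 (htp (∼χ) (Formula.realize_not.2 hn)) h1⟩
  have h1 := Formula.realize_relabel.1 (hy (Sum.inr (Sum.inr ())))
  rw [Formula.realize_not, Sum.comp_elim] at h1
  have hσa' : σ ∘ a = y ∘ Sum.inl := funext hσa
  refine h1 ?_
  have h2 := h σ hσ (y ∘ Sum.inr) fun τ hτ φ hφ => by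
    have h3 := Formula.realize_relabel.1 (hy (Sum.inl (⟨τ, hτ⟩, ⟨φ, hφ⟩)))
    rw [Sum.comp_elim] at h3
    exact h3
  rw [hσa'] at h2
  exact h2

theorem mk_formula_lt {L : Language.{u, v}} {α : Type max u v w} {κ : Cardinal.{max u v w}}
    (hκ : ℵ₀ < κ) (hL : Cardinal.lift.{w} L.card < κ) (hα : #α < κ) : #(L.Formula α) < κ := by
  have h1 : #(L.Formula α) ≤ #(Σ n, L.BoundedFormula α n) :=
    Cardinal.mk_le_of_injective (f := fun φ => ⟨0, φ⟩) fun φ ψ h => by simpa using h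
  refine (h1.trans BoundedFormula.card_le).trans_lt (max_lt hκ ?_)
  refine Cardinal.add_lt_of_lt hκ.le (by rwa [Cardinal.lift_id'.{max u v, w}]) ?_
  have h2 : Cardinal.lift.{max u v w} L.card = Cardinal.lift.{w} L.card := by
    rw [← Cardinal.lift_umax.{max u v, w}]
  rwa [h2]

end BoundedSubintersection

end FirstOrder.Language

theorem lemma2p3 {L : FirstOrder.Language.{u, v}} (T : L.Theory) (hT : T.IsComplete)
    (hNIP : FirstOrder.Language.Theory.IsNIP.{u, v, max u v w} T) :
    ∃ lam : Cardinal.{max u v w}, ∀ κ : Cardinal.{max u v w}, lam < κ →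
      ∀ (M : Type (max u v w)) [L.Structure M] [Nonempty M] [M ⊨ T],
        L.IsSaturated M κ → L.IsStronglyHomogeneous M κ →
      ∀ (G : Type z) [Group G] (D : L.DefinableGroup M G) (H : Subgroup G)
        (ι : Type (max u v w)) (a : ι → M) (p : Set (L.Formula (Fin D.n ⊕ ι))),
        #ι < κ → D.IsTypeDefinedBy H p a → D.IsStableQuotient κ H (Set.range a) →
      ∀ A : Set M, #A < κ →
        ∃ S ⊆ L.fixingAut A, #S < κ ∧
          (⨅ σ ∈ L.fixingAut A, H.map (D.act σ)) = (⨅ σ ∈ S, H.map (D.act σ)) ∧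
          ∀ (N : Type (max u v w)) [L.Structure N] (f : M ↪ₑ[L] N),
            (⋂ a' ∈ FirstOrder.Language.typeRealizations f A a, FirstOrder.Language.solutionSet p a') =
              ⋂ σ ∈ S, FirstOrder.Language.solutionSet p (fun i => f (σ (a i))) := by
  classical
  -- This bound makes the number of formulas in `p` less than κ, so a union of finite families
  -- indexed by `p` is small.
  refine ⟨max ℵ₀ (Cardinal.lift.{w} L.card), fun κ hlam M _ _ _ sat hom G _ D H ι a p hι hp hst A
    hA => ?_⟩
  obtain ⟨hκ, hL⟩ := max_lt_iff.1 hlam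
  choose F hFA hF using fun ψ : p => hp.exists_finset hNIP hst sat hom hκ hι A ψ.2
  have hcard : #p < κ := by
    refine (Cardinal.mk_subtype_le _).trans_lt (FirstOrder.Language.mk_formula_lt.{u, v, w} hκ hL ?_)
    rw [Cardinal.mk_sum, Cardinal.mk_fin, Cardinal.lift_natCast]
    exact Cardinal.add_lt_of_lt hκ.le (Cardinal.natCast_lt_aleph0.trans hκ) (by simpa using hι)
  have hSA : (⋃ ψ, (F ψ : Set (L.Equiv M M))) ⊆ L.fixingAut A := Set.iUnion_subset hFA
  refine ⟨_, hSA, ?_, ?_, fun N _ f => ?_⟩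
  · refine (Cardinal.mk_iUnion_le_sum_mk.trans
      (Cardinal.sum_le_sum _ (fun _ => ℵ₀) fun ψ => ?_)).trans_lt ?_
    · exact (Cardinal.mk_lt_aleph0 (α := F ψ)).le
    · rw [Cardinal.sum_const']
      exact Cardinal.mul_lt_of_lt hκ.le hcard hκ
  · refine le_antisymm (le_iInf₂ fun σ hσ => iInf₂_le σ (hSA hσ)) (le_iInf₂ fun σ hσ g hg => ?_)
    obtain ⟨x, hx, rfl⟩ := D.surj g
    simp only [Subgroup.mem_iInf] at hg
    refine (hp.map_act σ).proj_mem fun φ hφ => hF ⟨φ, hφ⟩ σ hσ x fun τ hτ => ?_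
    exact (hp.map_act τ).mem_solutionSet hx (hg τ (Set.mem_iUnion.2 ⟨_, hτ⟩))
  -- One inclusion holds since the image in `N` of σ(a), for σ fixing `A`, realizes tp(a/A); the
  -- other is the formula-by-formula transfer.
  · refine Set.Subset.antisymm (Set.subset_iInter₂ fun σ hσ => Set.iInter₂_subset _ ?_) ?_
    · intro φ
      rw [← FirstOrder.Language.StrongHomClass.realize_formula σ φ, ← f.map_formula, Sum.comp_elim, Sum.comp_elim]
      have h1 : (fun x : A => f (σ x)) = fun x : A => f x :=
        funext fun x => congrArg f (hSA hσ x x.2)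
      change φ.Realize (Sum.elim (fun x : A => f (σ x)) _) ↔ _
      rw [h1]
      rfl
    · refine Set.subset_iInter₂ fun a' ha' x hx φ hφ => ?_
      simp only [Set.mem_iInter] at hx
      exact FirstOrder.Language.realize_of_mem_typeRealizations sat hom hκ hι hA (hF ⟨φ, hφ⟩) f ha' fun τ hτ =>
        hx τ (Set.mem_iUnion.2 ⟨_, hτ⟩)
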